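/- Let $\mathsf f:(0,\infty)\to\mathbb R$ be convex with $\mathsf f(1)=0$; put $\mathsf f(0):=\mathsf f(0^+)\in(-\infty,\infty]$ and $\mathsf f'(\infty):=\lim_{t\to\infty}\mathsf f(t)/t\in(-\infty,\infty]$. For probability measures $P,Q$ on the same measurable space let \[D_{\mathsf f}(P\|Q)=\mathbb E_Q\Big[\mathsf f\Big(\frac{dP}{dQ}\Big)\Big]+\mathsf f'(\infty)\,P_s,\] where $dP/dQ$ is the density of the absolutely continuous part of $P$ and $P_s$ is the mass of the part of $P$ singular to $Q$ (with $\infty\cdot 0=0$); the last term is absent if $P\ll Q$. For random variables $A,B$ with joint law $P_{AB}$ (on arbitrary measurable spaces) let \[I^{CKZ}_{\mathsf f}(A;B)=D_{\mathsf f}(P_{AB}\|P_A\times P_B),\qquad I^{PV}_{\mathsf f}(A;B)=\inf_{Q_B:\,P_B\ll Q_B}D_{\mathsf f}(P_{AB}\|P_A\times Q_B),\] \[I^{MBGYA}_{\mathsf f}(A;B)=\inf_{Q_B:\,P_B\ll Q_B}\big\{D_{\mathsf f}(P_{AB}\|P_A\times Q_B)-D_{\mathsf f}(P_B\|Q_B)\big\},\]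 where the infima are over probability measures $Q_B$, in the last one over those for which $D_{\mathsf f}(P_B\|Q_B)<\infty$, so that the difference is meaningful. Let $I(A;B)$ be Shannon's mutual information in nats. For a random variable $Q$ with finitely many values let $I_{\mathsf f}(X;Y|Q)=\sum_q P_Q(q)\,I_{\mathsf f}(X;Y|Q=q)$. Let $\mathcal F$ be the class of convex $\mathsf f$ with $\mathsf f(1)=0$ that are twice differentiable on $(0,\infty)$ with $\mathsf f''>0$ and $1/\mathsf f''$ concave there. A channel is a Markov kernel $P_{Y|X}$. Then: (i) For every convex $\mathsf f$ as above, $I^{PV}_{\mathsf f}(X;Y)$ and $I^{MBGYA}_{\mathsf f}(X;Y)$ are concave in $P_X$ when the channel $P_{Y|X}$ is fixed; that is, $I^{PV}_{\mathsf f}(X;Y)\ge I^{PV}_{\mathsf f}(X;Y|Q)$ and $I^{MBGYA}_{\mathsf f}(X;Y)\ge I^{MBGYA}_{\mathsf f}(X;Y|Q)$ for every joint law $P_{X,Q}P_{Y|X}$ with $Q$ finitely valued. (ii) For every convex $\mathsf f$ as above, $I^{CKZ}_{\mathsf f}(X;Y)$ and $I^{PV}_{\mathsf f}(X;Y)$ are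 convex in the channel $P_{Y|X}$ when $P_X$ is fixed; that is, $I^{CKZ}_{\mathsf f}(X;Y)\le I^{CKZ}_{\mathsf f}(X;Y|Q)$ and $I^{PV}_{\mathsf f}(X;Y)\le I^{PV}_{\mathsf f}(X;Y|Q)$ for every joint law $P_QP_XP_{Y|X,Q}$ with $Q$ finitely valued. If $\mathsf f\in\mathcal F$, the same holds for $I^{MBGYA}_{\mathsf f}$. (iii) If $\mathsf f\in\mathcal F$, $X^n=(X_1,\dots,X_n)$ are independent random variables and $U$ is an arbitrary random variable (with an arbitrary joint law with $X^n$), then \[I^{CKZ}_{\mathsf f}(X^n;U)\ge\sum_{i=1}^nI^{CKZ}_{\mathsf f}(X_i;U),\qquad I^{MBGYA}_{\mathsf f}(X^n;U)\ge\sum_{i=1}^nI^{MBGYA}_{\mathsf f}(X_i;U).\] (iv) If $\mathsf f\in\mathcal F$, then $\lim_{t\to\infty}t\,\mathsf f''(t)$ exists in $[-\infty,\infty]$, and for every joint law of $(X,Y)$ (with $0\cdot\infty=0$) \[I(X;Y)\cdot\Big[\lim_{t\to\infty}t\,\mathsf f''(t)\Big]\ge I^{CKZ}_{\mathsf f}(X;Y)\ge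 I^{PV}_{\mathsf f}(X;Y)\ge I^{MBGYA}_{\mathsf f}(X;Y).\] -/

import Mathlib

open MeasureTheory ProbabilityTheory Filter Set
open scoped ENNReal NNReal Topology

noncomputable section

/-- The functions that generate an `f`-divergence: convex on `(0, ∞)` with `f 1 = 0`. Only the values
on `(0, ∞)` matter; the value at `0` is always taken to be the limit `f(0+)`, see `valueAtZero`. -/
structure IsGenerator (f : ℝ → ℝ) : Prop where
  convexOn : ConvexOn ℝ (Ioi 0) f
  map_one : f 1 = 0

/-- The class of convex functions `f` with `f 1 = 0` that are twice differentiable on `(0, ∞)`, with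
`f''` strictly positive and `1 / f''` concave there. -/
structure MemClassF (f : ℝ → ℝ) : Prop extends IsGenerator f where
  differentiableOn : DifferentiableOn ℝ f (Ioi 0)
  differentiableOn_deriv : DifferentiableOn ℝ (deriv f) (Ioi 0)
  deriv2_pos : ∀ t ∈ Ioi (0 : ℝ), 0 < deriv (deriv f) t
  concaveOn_inv : ConcaveOn ℝ (Ioi 0) (fun t => 1 / deriv (deriv f) t)

/-- `f(0+)`, possibly `+∞`. For convex `f` the `limsup` is a limit. -/
def valueAtZero (f : ℝ → ℝ) : EReal :=
  limsup (fun t : ℝ => (f t : EReal)) (𝓝[>] 0)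

/-- `f'(∞) = lim f(t) / t` for `t → ∞`, possibly `+∞`. For convex `f` the `limsup` is a limit. -/
def slopeAtTop (f : ℝ → ℝ) : EReal :=
  limsup (fun t : ℝ => ((f t / t : ℝ) : EReal)) atTop

open Classical in
/-- The integral of `f (dP/dQ)` with respect to `Q` over the set where `dP/dQ ≠ 0`. As `f` is bounded
below by an affine function, the negative part is always integrable, so that a failure of
integrability means that the integral is `+∞`. -/
def densityIntegral {α : Type*} [MeasurableSpace α] (f : ℝ → ℝ) (P Q : Measure α) : EReal :=
  if IntegrableOn (fun x => f (P.rnDeriv Q x).toReal) {x | P.rnDeriv Q x ≠ 0} Q then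
    ((∫ x in {x | P.rnDeriv Q x ≠ 0}, f (P.rnDeriv Q x).toReal ∂Q : ℝ) : EReal)
  else ⊤

/-- The `f`-divergence `D_f(P ‖ Q)`. The first two summands are the expectation of `f (dP/dQ)` under
`Q` with `f 0 = f(0+)`. The third vanishes if `P ≪ Q`; otherwise it is the usual contribution
`f'(∞) · P_s` of the part of `P` that is singular to `Q`. (In `EReal`, `⊤ * 0 = 0`.) -/
def fDiv {α : Type*} [MeasurableSpace α] (f : ℝ → ℝ) (P Q : Measure α) : EReal :=
  densityIntegral f P Q
    + valueAtZero f * ((Q {x | P.rnDeriv Q x = 0} : ℝ≥0∞) : EReal)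
    + slopeAtTop f * ((P.singularPart Q univ : ℝ≥0∞) : EReal)

/-- `I_f^CKZ(A;B) = D_f(P_AB ‖ P_A × P_B)` for the joint law `ρ = P_AB`. -/
def infoCKZ {α β : Type*} [MeasurableSpace α] [MeasurableSpace β]
    (f : ℝ → ℝ) (ρ : Measure (α × β)) : EReal :=
  fDiv f ρ (ρ.fst.prod ρ.snd)

/-- `I_f^PV(A;B)`, the infimum of `D_f(P_AB ‖ P_A × Q_B)` over all probability measures `Q_B` with
`P_B ≪ Q_B`, for the joint law `ρ = P_AB`. -/
def infoPV {α β : Type*} [MeasurableSpace α] [MeasurableSpace β]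
    (f : ℝ → ℝ) (ρ : Measure (α × β)) : EReal :=
  ⨅ (Q : Measure β) (_ : IsProbabilityMeasure Q) (_ : ρ.snd ≪ Q), fDiv f ρ (ρ.fst.prod Q)

/-- `I_f^MBGYA(A;B)`, the infimum of `D_f(P_AB ‖ P_A × Q_B) - D_f(P_B ‖ Q_B)` over all probability
measures `Q_B` with `P_B ≪ Q_B`, for the joint law `ρ = P_AB`. Where `D_f(P_B ‖ Q_B) = ∞` the first
term is infinite as well (data processing) and the difference `∞ - ∞` has no meaning; such `Q_B` do
not take part in the infimum. -/
def infoMBGYA {α β : Type*} [MeasurableSpace α] [MeasurableSpace β]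
    (f : ℝ → ℝ) (ρ : Measure (α × β)) : EReal :=
  ⨅ (Q : Measure β) (_ : IsProbabilityMeasure Q) (_ : ρ.snd ≪ Q) (_ : fDiv f ρ.snd Q ≠ ⊤),
    fDiv f ρ (ρ.fst.prod Q) - fDiv f ρ.snd Q

/-- Shannon's mutual information (in nats) of the joint law `ρ`. -/
def shannonInfo {α β : Type*} [MeasurableSpace α] [MeasurableSpace β]
    (ρ : Measure (α × β)) : EReal :=
  ((InformationTheory.klDiv ρ (ρ.fst.prod ρ.snd) : ℝ≥0∞) : EReal)

/-- The average channel `∑ q, w q • κ q`. -/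
def mixChannel {ι α β : Type*} [Fintype ι] [MeasurableSpace α] [MeasurableSpace β]
    (w : ι → ℝ≥0) (κ : ι → Kernel α β) : Kernel α β where
  toFun x := ∑ q, w q • κ q x
  measurable' := by
    refine Measure.measurable_of_measurable_coe _ fun s hs => ?_
    simp only [Measure.coe_finsetSum, Finset.sum_apply, Measure.smul_apply]
    exact Finset.measurable_sum _ fun q _ => ((κ q).measurable_coe hs).const_smul (w q)

/-- The conditional information `I(X;Y|Q) = ∑ q, P(Q = q) I(X;Y|Q = q)` for a random variable `Q` with
finitely many values, where `w q = P(Q = q)` and `ρ q` is the law of `(X, Y)` given `Q = q`. -/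
def condInfo {ι α β : Type*} [Fintype ι] [MeasurableSpace α] [MeasurableSpace β]
    (I : Measure (α × β) → EReal) (w : ι → ℝ≥0) (ρ : ι → Measure (α × β)) : EReal :=
  ∑ q, ((w q : ℝ) : EReal) * I (ρ q)

end

/-! Subtracting `c (t - 1)` from `f` changes no divergence between probability measures. Taking for
`c` the slope of a supporting line at `1`, one may assume `f ≥ 0`, and all quantities live in
`ℝ≥0∞`. Then `D_f(P ‖ Q)` is the integral of the perspective `q f(p / q)` of the densities `p`, `q`
with respect to any dominating finite measure. The perspective is homogeneous of degree one and
subadditive, being a countable supremum of positive parts of linear functions. This gives data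
processing (`eDiv_map_le`), joint convexity (`eDiv_sum_le`) and superadditivity under splitting both
measures by common densities (`sum_eDiv_withDensity_le`).

For fixed `κ` and `Q`, the last property makes `D(P ⊗ κ ‖ P × Q)` concave in `P`, while `D(P_Y ‖ Q)`
is convex in `P`; both claims of (i) follow. For CKZ and PV, (ii) is joint convexity with the
reference laws mixed along with the channels.

The statements on MBGYA in (ii) and both statements of (iii) rest on `eDiv_add_eDiv_snd_le`: for `f`
in the class, `D(P_AB ‖ P × M) - D(P_B ‖ M)` decreases when `B` is replaced by `g(B)`. If `r` and
`r_B` are the two densities, then `r_B` is the average of `r` over `P`, so the difference is the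
integral of the Bregman divergence `f(r) - f(r_B) - f'(r_B)(r - r_B)`. This is jointly convex
because `1 / f''` is concave (`bregman_convex`), and the claim is Jensen's inequality along the
fibres of `g`. To work on arbitrary measurable spaces, conditional expectations are avoided:
divergences are suprema of tangent functionals (`tangentFunctional_le`, `toReal_eDiv_le`), and the
supporting hyperplanes of the Bregman divergence (`isMinorant_bregman`) provide the inequality
between these functionals.

Forgetting the label of a labelled mixture gives convexity of MBGYA; forgetting all but one of the
independent variables gives, by induction, (iii). For (iv), positivity and concavity of `1 / f''`
make `t f''(t)` increasing, so `f'' ≤ L / t`, and two integrations from `1` compare `f` with `L (t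
log t - t + 1)`. -/

/-! ### The perspective of a nonnegative generator. -/

/-- A generator of an `f`-divergence that is nonnegative on `(0, ∞)`. -/
structure IsNonnegGenerator (f : ℝ → ℝ) : Prop extends IsGenerator f where
  nonneg : ∀ t, 0 < t → 0 ≤ f t

/-- The affine function `a t + b` lies below `f` on `(0, ∞)`. -/
def IsMinorant (f : ℝ → ℝ) (a b : ℝ) : Prop := ∀ t, 0 < t → a * t + b ≤ f t

/-- The homogeneous function `(a p + b q)⁺` of two extended nonnegative numbers. -/
noncomputable def homAffine (a b : ℝ) (p q : ℝ≥0∞) : ℝ≥0∞ :=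
  (ENNReal.ofReal a * p + ENNReal.ofReal b * q)
    - (ENNReal.ofReal (-a) * p + ENNReal.ofReal (-b) * q)

/-- The index set of the affine minorants with rational coefficients. -/
abbrev RatMinorant (f : ℝ → ℝ) : Type := {c : ℚ × ℚ // IsMinorant f c.1 c.2}

/-- The perspective `q f(p / q)` of `f`, as a supremum of countably many homogeneous functions. -/
noncomputable def persp (f : ℝ → ℝ) (p q : ℝ≥0∞) : ℝ≥0∞ :=
  ⨆ c : RatMinorant f, homAffine c.1.1 c.1.2 p q

lemma ENNReal.ofReal_le_of_forall_lt {x : ℝ} {S : ℝ≥0∞}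
    (h : ∀ y < x, ENNReal.ofReal y ≤ S) : ENNReal.ofReal x ≤ S := by
  refine ENNReal.le_of_forall_nnreal_lt fun r hr => ?_
  have hr' : (r : ℝ) < x := by
    rw [← ENNReal.ofReal_coe_nnreal] at hr
    by_contra! hle
    exact absurd (ENNReal.ofReal_le_ofReal hle) (not_le.2 hr)
  simpa using h r hr'

lemma homAffine_eq_ofReal (a b : ℝ) {p q : ℝ≥0∞} (hp : p ≠ ∞) (hq : q ≠ ∞) :
    homAffine a b p q = ENNReal.ofReal (a * p.toReal + b * q.toReal) := by
  lift p to ℝ≥0 using hp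
  lift q to ℝ≥0 using hq
  have key : ∀ c : ℝ, ∀ r : ℝ≥0, ENNReal.ofReal c * (r : ℝ≥0∞)
      = ENNReal.ofReal (max c 0 * r) := fun c r => by
    rw [ENNReal.ofReal_mul (le_max_right _ _), ENNReal.ofReal_coe_nnreal]
    rcases le_total c 0 with h | h <;> simp [h]
  have hn : ∀ c : ℝ, ∀ r : ℝ≥0, 0 ≤ max c 0 * (r : ℝ) := fun c r => by positivity
  have hc : ∀ c : ℝ, max c 0 - max (-c) 0 = c := fun c => by
    rcases le_total c 0 with h | h <;> simp [h]
  rw [homAffine, key, key, key, key, ← ENNReal.ofReal_add (hn _ _) (hn _ _),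
    ← ENNReal.ofReal_add (hn _ _) (hn _ _), ← ENNReal.ofReal_sub _ (add_nonneg (hn _ _) (hn _ _))]
  congr 1
  simp only [ENNReal.coe_toReal]
  linear_combination (p : ℝ) * hc a + (q : ℝ) * hc b

lemma measurable_homAffine (a b : ℝ) : Measurable fun x : ℝ≥0∞ × ℝ≥0∞ => homAffine a b x.1 x.2 := by
  unfold homAffine
  fun_prop

lemma measurable_persp (f : ℝ → ℝ) : Measurable fun x : ℝ≥0∞ × ℝ≥0∞ => persp f x.1 x.2 :=
  Measurable.iSup fun _ => measurable_homAffine _ _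

lemma Measurable.persp {α : Type*} [MeasurableSpace α] (f : ℝ → ℝ) {p q : α → ℝ≥0∞}
    (hp : Measurable p) (hq : Measurable q) : Measurable fun x => persp f (p x) (q x) :=
  (measurable_persp f).comp (hp.prodMk hq)

/-- Lowering both coefficients keeps a minorant below `f`, since `t > 0`; hence rational
coefficients suffice. With `persp_le`, this lets real minorants be used while the supremum stays
countable. -/
lemma ofReal_le_persp {f : ℝ → ℝ} {a b : ℝ} (h : IsMinorant f a b) {p q : ℝ≥0∞}
    (hp : p ≠ ∞) (hq : q ≠ ∞) :
    ENNReal.ofReal (a * p.toReal + b * q.toReal) ≤ persp f p q := by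
  refine ENNReal.ofReal_le_of_forall_lt fun y hy => ?_
  set P := p.toReal
  set Q := q.toReal
  have hP : 0 ≤ P := ENNReal.toReal_nonneg
  have hQ : 0 ≤ Q := ENNReal.toReal_nonneg
  -- Lowering `a` and `b` by less than `δ` costs at most `δ (P + Q)`, which the gap above `y` can
  -- pay; the `+ 1` in the denominator covers `P + Q = 0`.
  obtain ⟨δ, hδ, hδy⟩ : ∃ δ > 0, δ * (P + Q) ≤ a * P + b * Q - y := by
    refine ⟨(a * P + b * Q - y) / (P + Q + 1), by apply div_pos <;> linarith, ?_⟩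
    rw [div_mul_eq_mul_div, div_le_iff₀ (by linarith)]
    nlinarith
  obtain ⟨a', ha1, ha2⟩ := exists_rat_btwn (show a - δ < a by linarith)
  obtain ⟨b', hb1, hb2⟩ := exists_rat_btwn (show b - δ < b by linarith)
  have hm : IsMinorant f a' b' := fun t ht =>
    le_trans (by nlinarith) (h t ht)
  refine le_trans ?_ (le_iSup (fun c : RatMinorant f => homAffine c.1.1 c.1.2 p q) ⟨(a', b'), hm⟩)
  rw [homAffine_eq_ofReal _ _ hp hq]
  refine ENNReal.ofReal_le_ofReal ?_
  change y ≤ a' * P + b' * Q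
  nlinarith

lemma persp_le {f : ℝ → ℝ} {p q C : ℝ≥0∞} (hp : p ≠ ∞) (hq : q ≠ ∞)
    (h : ∀ a b, IsMinorant f a b → ENNReal.ofReal (a * p.toReal + b * q.toReal) ≤ C) :
    persp f p q ≤ C :=
  iSup_le fun c => by
    rw [homAffine_eq_ofReal _ _ hp hq]
    exact h _ _ c.2

lemma ConvexOn.exists_isMinorant {f : ℝ → ℝ} (hf : ConvexOn ℝ (Ioi 0) f) {t : ℝ} (ht : 0 < t) :
    ∃ c, IsMinorant f c (f t - c * t) := by
  have hint : t ∈ interior (Ioi (0 : ℝ)) := by simpa using ht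
  refine ⟨derivWithin f (Ioi t) t, fun s hs => ?_⟩
  rcases lt_trichotomy s t with h | h | h
  · have h1 := (hf.slope_le_leftDeriv_of_mem_interior hs hint h).trans
      (hf.leftDeriv_le_rightDeriv_of_mem_interior hint)
    rw [slope_def_field, div_le_iff₀ (by linarith)] at h1
    linarith
  · subst h; linarith
  · have h1 := hf.rightDeriv_le_slope_of_mem_interior hint hs h
    rw [slope_def_field, le_div_iff₀ (by linarith)] at h1
    linarith

namespace IsNonnegGenerator

variable {f : ℝ → ℝ}

lemma isMinorant_zero (hf : IsNonnegGenerator f) : IsMinorant f 0 0 := fun t ht => by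
  simpa using hf.nonneg t ht

lemma persp_of_pos (hf : IsNonnegGenerator f) {p q : ℝ≥0∞} (hp : p ≠ ∞) (hq : q ≠ ∞)
    (hp0 : p ≠ 0) (hq0 : q ≠ 0) : persp f p q = q * ENNReal.ofReal (f (p / q).toReal) := by
  have hP : 0 < p.toReal := ENNReal.toReal_pos hp0 hp
  have hQ : 0 < q.toReal := ENNReal.toReal_pos hq0 hq
  have ht : 0 < p.toReal / q.toReal := div_pos hP hQ
  have hq' : q = ENNReal.ofReal q.toReal := (ENNReal.ofReal_toReal hq).symm
  have hR : q * ENNReal.ofReal (f (p / q).toReal)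
      = ENNReal.ofReal (q.toReal * f (p.toReal / q.toReal)) := by
    rw [ENNReal.toReal_div, ENNReal.ofReal_mul hQ.le, ← hq']
  have e : ∀ a b : ℝ, a * p.toReal + b * q.toReal
      = q.toReal * (a * (p.toReal / q.toReal) + b) := fun a b => by field_simp
  rw [hR]
  refine le_antisymm (persp_le hp hq fun a b h => ?_) ?_
  · rw [e]
    exact ENNReal.ofReal_le_ofReal (mul_le_mul_of_nonneg_left (h _ ht) hQ.le)
  · obtain ⟨c, hc⟩ := hf.convexOn.exists_isMinorant ht
    refine le_trans (le_of_eq ?_) (ofReal_le_persp hc hp hq)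
    rw [e]
    congr 2
    ring

lemma coe_le_valueAtZero {a b : ℝ} (h : IsMinorant f a b) : (b : EReal) ≤ valueAtZero f := by
  have h1 : Tendsto (fun t : ℝ => ((a * t + b : ℝ) : EReal)) (𝓝[>] 0) (𝓝 (b : EReal)) := by
    refine (continuous_coe_real_ereal.tendsto b).comp ?_
    have : ContinuousAt (fun t : ℝ => a * t + b) 0 := by fun_prop
    simpa [ContinuousAt] using this.tendsto.mono_left nhdsWithin_le_nhds
  rw [← h1.limsup_eq]
  refine limsup_le_limsup ?_
  filter_upwards [self_mem_nhdsWithin] with t ht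
  exact EReal.coe_le_coe_iff.2 (h t ht)

lemma coe_le_slopeAtTop {a b : ℝ} (h : IsMinorant f a b) : (a : EReal) ≤ slopeAtTop f := by
  have h1 : Tendsto (fun t : ℝ => ((a + b / t : ℝ) : EReal)) atTop (𝓝 (a : EReal)) := by
    refine (continuous_coe_real_ereal.tendsto a).comp ?_
    simpa using (tendsto_const_nhds (x := a)).add (tendsto_const_nhds.div_atTop tendsto_id (a := b))
  rw [← h1.limsup_eq]
  refine limsup_le_limsup ?_
  filter_upwards [eventually_gt_atTop 0] with t ht
  rw [EReal.coe_le_coe_iff, le_div_iff₀ ht]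
  have := h t ht
  field_simp
  linarith

lemma valueAtZero_nonneg (hf : IsNonnegGenerator f) : 0 ≤ valueAtZero f :=
  coe_le_valueAtZero hf.isMinorant_zero

lemma slopeAtTop_nonneg (hf : IsNonnegGenerator f) : 0 ≤ slopeAtTop f :=
  coe_le_slopeAtTop hf.isMinorant_zero

/-- Take a supporting line at some `t < 1` with `f t > y`. Since `f 1 = 0 ≤ f t`, its slope is
nonpositive, so its intercept is at least `f t`. -/
lemma exists_isMinorant_of_lt_valueAtZero (hf : IsNonnegGenerator f) {y : ℝ}
    (hy : (y : EReal) < valueAtZero f) : ∃ a b, IsMinorant f a b ∧ y ≤ b := by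
  have h1 := (frequently_lt_of_lt_limsup (by isBoundedDefault) hy).and_eventually
    (inter_mem self_mem_nhdsWithin (mem_nhdsWithin_of_mem_nhds (Iio_mem_nhds one_pos)))
  obtain ⟨t, hyt, ht0, ht1⟩ := h1.exists
  simp only [mem_Ioi, mem_Iio] at ht0 ht1
  obtain ⟨c, hc⟩ := hf.convexOn.exists_isMinorant ht0
  refine ⟨c, _, hc, ?_⟩
  have h2 := hc 1 one_pos
  have h3 := hf.nonneg t ht0
  rw [hf.map_one] at h2
  have h4 : c ≤ 0 := by nlinarith
  have := EReal.coe_lt_coe_iff.1 hyt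
  nlinarith

/-- Take a supporting line at some `t > 1` with `f t > y t`. As it is nonpositive at `1`, its slope
`c` satisfies `c (t - 1) ≥ f t > y t`, hence `c ≥ y`. -/
lemma exists_isMinorant_of_lt_slopeAtTop (hf : IsNonnegGenerator f) {y : ℝ}
    (hy : (y : EReal) < slopeAtTop f) : ∃ a b, IsMinorant f a b ∧ y ≤ a := by
  have h1 := (frequently_lt_of_lt_limsup (by isBoundedDefault) hy).and_eventually
    (eventually_gt_atTop 1)
  obtain ⟨t, hyt, ht1⟩ := h1.exists
  have ht0 : 0 < t := by linarith
  obtain ⟨c, hc⟩ := hf.convexOn.exists_isMinorant ht0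
  refine ⟨c, _, hc, ?_⟩
  have h2 := hc 1 one_pos
  have h3 := hf.nonneg t ht0
  rw [hf.map_one] at h2
  have h4 := EReal.coe_lt_coe_iff.1 hyt
  rw [lt_div_iff₀ ht0] at h4
  have h5 : 0 ≤ c := by
    by_contra! hc0
    nlinarith
  rcases le_total y 0 with hy0 | hy0
  · exact hy0.trans h5
  · by_contra! hlt
    nlinarith

lemma persp_zero_left (hf : IsNonnegGenerator f) {q : ℝ≥0∞} (hq : q ≠ ∞) :
    persp f 0 q = (valueAtZero f).toENNReal * q := by
  refine le_antisymm (persp_le (by simp) hq fun a b h => ?_) ?_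
  · rw [ENNReal.toReal_zero, mul_zero, zero_add]
    rcases le_total b 0 with hb | hb
    · rw [ENNReal.ofReal_of_nonpos (mul_nonpos_of_nonpos_of_nonneg hb ENNReal.toReal_nonneg)]
      exact zero_le
    rw [ENNReal.ofReal_mul hb, ENNReal.ofReal_toReal hq]
    gcongr
    rw [← EReal.real_coe_toENNReal]
    exact EReal.toENNReal_le_toENNReal (coe_le_valueAtZero h)
  · rcases eq_or_ne q 0 with rfl | hq0
    · simp
    rw [← ENNReal.le_div_iff_mul_le (Or.inl hq0) (Or.inl hq)]
    refine ENNReal.le_of_forall_nnreal_lt fun r hr => ?_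
    rw [ENNReal.le_div_iff_mul_le (Or.inl hq0) (Or.inl hq)]
    have hr' : ((r : ℝ) : EReal) < valueAtZero f := by
      rw [← EReal.coe_toENNReal hf.valueAtZero_nonneg]
      exact EReal.coe_ennreal_lt_coe_ennreal_iff.2 hr
    obtain ⟨a, b, h, hb⟩ := hf.exists_isMinorant_of_lt_valueAtZero hr'
    refine le_trans ?_ (ofReal_le_persp h (by simp) hq)
    rw [ENNReal.toReal_zero, mul_zero, zero_add, ENNReal.ofReal_mul (r.2.trans hb),
      ENNReal.ofReal_toReal hq]
    gcongr
    rw [← ENNReal.ofReal_coe_nnreal]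
    exact ENNReal.ofReal_le_ofReal hb

lemma persp_zero_right (hf : IsNonnegGenerator f) {p : ℝ≥0∞} (hp : p ≠ ∞) :
    persp f p 0 = (slopeAtTop f).toENNReal * p := by
  refine le_antisymm (persp_le hp (by simp) fun a b h => ?_) ?_
  · rw [ENNReal.toReal_zero, mul_zero, add_zero]
    rcases le_total a 0 with ha | ha
    · rw [ENNReal.ofReal_of_nonpos (mul_nonpos_of_nonpos_of_nonneg ha ENNReal.toReal_nonneg)]
      exact zero_le
    rw [ENNReal.ofReal_mul ha, ENNReal.ofReal_toReal hp]
    gcongr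
    rw [← EReal.real_coe_toENNReal]
    exact EReal.toENNReal_le_toENNReal (coe_le_slopeAtTop h)
  · rcases eq_or_ne p 0 with rfl | hp0
    · simp
    rw [← ENNReal.le_div_iff_mul_le (Or.inl hp0) (Or.inl hp)]
    refine ENNReal.le_of_forall_nnreal_lt fun r hr => ?_
    rw [ENNReal.le_div_iff_mul_le (Or.inl hp0) (Or.inl hp)]
    have hr' : ((r : ℝ) : EReal) < slopeAtTop f := by
      rw [← EReal.coe_toENNReal hf.slopeAtTop_nonneg]
      exact EReal.coe_ennreal_lt_coe_ennreal_iff.2 hr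
    obtain ⟨a, b, h, ha⟩ := hf.exists_isMinorant_of_lt_slopeAtTop hr'
    refine le_trans ?_ (ofReal_le_persp h hp (by simp))
    rw [ENNReal.toReal_zero, mul_zero, add_zero, ENNReal.ofReal_mul (r.2.trans ha),
      ENNReal.ofReal_toReal hp]
    gcongr
    rw [← ENNReal.ofReal_coe_nnreal]
    exact ENNReal.ofReal_le_ofReal ha

end IsNonnegGenerator

lemma homAffine_mul (a b : ℝ) {g p q : ℝ≥0∞} (hg : g ≠ ∞) :
    homAffine a b (g * p) (g * q) = g * homAffine a b p q := by
  unfold homAffine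
  rw [ENNReal.mul_sub fun _ _ => hg]
  ring_nf

lemma persp_mul (f : ℝ → ℝ) {g p q : ℝ≥0∞} (hg : g ≠ ∞) :
    persp f (g * p) (g * q) = g * persp f p q := by
  simp only [persp, homAffine_mul _ _ hg, ENNReal.mul_iSup]

lemma homAffine_add_le (a b : ℝ) (p q p' q' : ℝ≥0∞) :
    homAffine a b (p + p') (q + q') ≤ homAffine a b p q + homAffine a b p' q' := by
  unfold homAffine
  rw [tsub_le_iff_right]
  have h : ∀ x y, ENNReal.ofReal x * (p + p') + ENNReal.ofReal y * (q + q')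
      = (ENNReal.ofReal x * p + ENNReal.ofReal y * q)
        + (ENNReal.ofReal x * p' + ENNReal.ofReal y * q') := fun x y => by ring
  rw [h, h]
  exact (add_le_add le_tsub_add le_tsub_add).trans_eq (add_add_add_comm _ _ _ _)

lemma persp_add_le (f : ℝ → ℝ) (p q p' q' : ℝ≥0∞) :
    persp f (p + p') (q + q') ≤ persp f p q + persp f p' q' :=
  iSup_le fun c => (homAffine_add_le _ _ _ _ _ _).trans
    (add_le_add (le_iSup (fun c : RatMinorant f => homAffine c.1.1 c.1.2 p q) c)
      (le_iSup (fun c : RatMinorant f => homAffine c.1.1 c.1.2 p' q') c))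

lemma persp_zero_zero (f : ℝ → ℝ) : persp f 0 0 = 0 := by
  simp [persp, homAffine]

lemma persp_sum_le {ι : Type*} (f : ℝ → ℝ) (s : Finset ι) (p q : ι → ℝ≥0∞) :
    persp f (∑ i ∈ s, p i) (∑ i ∈ s, q i) ≤ ∑ i ∈ s, persp f (p i) (q i) := by
  classical
  induction s using Finset.induction_on with
  | empty => simp [persp_zero_zero]
  | insert i s hi ih =>
    rw [Finset.sum_insert hi, Finset.sum_insert hi, Finset.sum_insert hi]
    exact (persp_add_le _ _ _ _ _).trans (by gcongr)

/-! ### The divergence as an integral of the perspective. -/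

/-- The `f`-divergence of two finite measures as an extended nonnegative number, computed from the
densities with respect to `P + Q`. -/
noncomputable def eDiv {α : Type*} [MeasurableSpace α] (f : ℝ → ℝ) (P Q : Measure α) : ℝ≥0∞ :=
  ∫⁻ x, persp f (P.rnDeriv (P + Q) x) (Q.rnDeriv (P + Q) x) ∂(P + Q)

section

variable {α : Type*} [MeasurableSpace α]

/-- Independence of the dominating measure: changing from `P + Q` to `μ` multiplies both densities
by the common factor `p + q`, which homogeneity pulls out of the perspective. -/
lemma eDiv_withDensity (f : ℝ → ℝ) (μ : Measure α) [IsFiniteMeasure μ] {p q : α → ℝ≥0∞}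
    (hp : Measurable p) (hq : Measurable q) [IsFiniteMeasure (μ.withDensity p)]
    [IsFiniteMeasure (μ.withDensity q)] :
    eDiv f (μ.withDensity p) (μ.withDensity q) = ∫⁻ x, persp f (p x) (q x) ∂μ := by
  set P := μ.withDensity p with hP
  set Q := μ.withDensity q with hQ
  have hPQ : P + Q = μ.withDensity (p + q) := (withDensity_add_left hp q).symm
  have hpq : Measurable (p + q) := hp.add hq
  have key : ∀ {R : Measure α} {r : α → ℝ≥0∞}, IsFiniteMeasure R → Measurable r →
      R = μ.withDensity r → R ≪ P + Q → ∀ᵐ x ∂μ, r x = (p + q) x * R.rnDeriv (P + Q) x := by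
    intro R r _ hr hR hac
    have h1 : R = μ.withDensity ((p + q) * R.rnDeriv (P + Q)) := by
      rw [withDensity_mul _ hpq (Measure.measurable_rnDeriv _ _), ← hPQ]
      exact (Measure.withDensity_rnDeriv_eq _ _ hac).symm
    rw [hR] at h1
    refine (withDensity_eq_iff_of_sigmaFinite hr.aemeasurable ?_).1 (h1.trans ?_)
    · exact (hpq.mul (Measure.measurable_rnDeriv _ _)).aemeasurable
    · rw [← hR]; rfl
  have hpe := key inferInstance hp hP (Measure.le_add_right le_rfl).absolutelyContinuous
  have hqe := key inferInstance hq hQ (Measure.le_add_left le_rfl).absolutelyContinuous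
  have hfin : ∀ᵐ x ∂μ, (p + q) x < ∞ := by
    refine ae_lt_top hpq ?_
    have := measure_ne_top (P + Q) univ
    rwa [hPQ, withDensity_apply _ MeasurableSet.univ, Measure.restrict_univ] at this
  unfold eDiv
  conv_lhs => rw [hPQ]
  rw [lintegral_withDensity_eq_lintegral_mul _ hpq
    ((Measure.measurable_rnDeriv _ _).persp f (Measure.measurable_rnDeriv _ _))]
  refine lintegral_congr_ae ?_
  filter_upwards [hpe, hqe, hfin] with x h1 h2 h3
  rw [Pi.mul_apply, ← persp_mul f h3.ne, ← hPQ, ← h1, ← h2]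

lemma eDiv_eq_rnDeriv (f : ℝ → ℝ) (P Q : Measure α) [IsFiniteMeasure P] [IsFiniteMeasure Q] :
    eDiv f P Q = ∫⁻ x, persp f (P.rnDeriv Q x) 1 ∂Q
      + persp f 1 0 * P.singularPart Q univ := by
  obtain ⟨N, hN, hPs, hQN⟩ := Measure.mutuallySingular_singularPart P Q
  set S := P.singularPart Q
  set r := P.rnDeriv Q
  have hr : Measurable r := Measure.measurable_rnDeriv _ _
  -- `Q` lives on `N` and the singular part `S` on its complement, so with respect to `Q + S` the
  -- pair of densities is `(r, 1)` on `N` and `(1, 0)` off `N`.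
  have hP : P = (Q + S).withDensity (N.indicator r + Nᶜ.indicator 1) := by
    rw [withDensity_add_left (hr.indicator hN), withDensity_indicator hN,
      withDensity_indicator hN.compl, Measure.restrict_add, Measure.restrict_add,
      Measure.restrict_eq_zero.2 hPs, Measure.restrict_eq_zero.2 hQN, add_zero, zero_add,
      withDensity_one, Measure.restrict_eq_self_of_ae_mem, Measure.restrict_eq_self_of_ae_mem,
      Measure.rnDeriv_add_singularPart]
    · exact measure_eq_zero_iff_ae_notMem.1 hPs
    · filter_upwards [measure_eq_zero_iff_ae_notMem.1 hQN] with x hx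
      simpa using hx
  have hQ : Q = (Q + S).withDensity (N.indicator 1) := by
    rw [withDensity_indicator hN, Measure.restrict_add, Measure.restrict_eq_zero.2 hPs, add_zero,
      withDensity_one, Measure.restrict_eq_self_of_ae_mem]
    filter_upwards [measure_eq_zero_iff_ae_notMem.1 hQN] with x hx
    simpa using hx
  have hm1 : Measurable (N.indicator r + Nᶜ.indicator 1) :=
    (hr.indicator hN).add (measurable_one.indicator hN.compl)
  have hm2 : Measurable (N.indicator (1 : α → ℝ≥0∞)) := measurable_one.indicator hN
  have : IsFiniteMeasure ((Q + S).withDensity (N.indicator r + Nᶜ.indicator 1)) := hP ▸ ‹_›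
  have : IsFiniteMeasure ((Q + S).withDensity (N.indicator 1)) := hQ ▸ ‹_›
  have h := eDiv_withDensity f (Q + S) hm1 hm2
  rw [← hP, ← hQ] at h
  rw [h, lintegral_add_measure]
  congr 1
  · refine lintegral_congr_ae ?_
    filter_upwards [measure_eq_zero_iff_ae_notMem.1 hQN] with x hx
    have hx : x ∈ N := by simpa using hx
    simp [hx]
  · rw [← lintegral_const]
    refine lintegral_congr_ae ?_
    filter_upwards [measure_eq_zero_iff_ae_notMem.1 hPs] with x hx
    simp [hx]

lemma IsGenerator.measurable_indicator {f : ℝ → ℝ} (hf : IsGenerator f) :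
    Measurable ((Ioi (0 : ℝ)).indicator f) := by
  classical
  rw [← piecewise_eq_indicator]
  exact (hf.convexOn.continuousOn isOpen_Ioi).measurable_piecewise continuousOn_const
    measurableSet_Ioi

lemma rnDeriv_toReal_pos_ae (P Q : Measure α) [IsFiniteMeasure P] [IsFiniteMeasure Q] :
    ∀ᵐ x ∂Q.restrict {x | P.rnDeriv Q x ≠ 0}, 0 < (P.rnDeriv Q x).toReal := by
  have hm : MeasurableSet {x | P.rnDeriv Q x ≠ 0} :=
    ((Measure.measurable_rnDeriv P Q) (measurableSet_singleton 0)).compl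
  rw [ae_restrict_iff' hm]
  filter_upwards [Measure.rnDeriv_lt_top P Q] with x hx h0
  exact ENNReal.toReal_pos h0 hx.ne

lemma IsGenerator.aestronglyMeasurable {f : ℝ → ℝ} (hf : IsGenerator f) (P Q : Measure α)
    [IsFiniteMeasure P] [IsFiniteMeasure Q] :
    AEStronglyMeasurable (fun x => f (P.rnDeriv Q x).toReal)
      (Q.restrict {x | P.rnDeriv Q x ≠ 0}) := by
  refine ((hf.measurable_indicator.comp
    (Measure.measurable_rnDeriv P Q).ennreal_toReal).aestronglyMeasurable).congr ?_
  filter_upwards [rnDeriv_toReal_pos_ae P Q] with x hx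
  simp [hx]

lemma IsNonnegGenerator.densityIntegral_eq {f : ℝ → ℝ} (hf : IsNonnegGenerator f)
    (P Q : Measure α) [IsFiniteMeasure P] [IsFiniteMeasure Q] :
    densityIntegral f P Q = ((∫⁻ x in {x | P.rnDeriv Q x ≠ 0},
      ENNReal.ofReal (f (P.rnDeriv Q x).toReal) ∂Q : ℝ≥0∞) : EReal) := by
  have h0 : 0 ≤ᵐ[Q.restrict {x | P.rnDeriv Q x ≠ 0}] fun x => f (P.rnDeriv Q x).toReal := by
    filter_upwards [rnDeriv_toReal_pos_ae P Q] with x hx using hf.nonneg _ hx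
  have hm := hf.toIsGenerator.aestronglyMeasurable P Q
  unfold densityIntegral
  split_ifs with h
  · rw [← ofReal_integral_eq_lintegral_ofReal h h0, EReal.coe_ennreal_ofReal,
      max_eq_left (integral_nonneg_of_ae h0)]
  · have := (lintegral_ofReal_ne_top_iff_integrable hm h0).not.2 h
    rw [not_not.1 this, EReal.coe_ennreal_top]

/-- The three summands of `fDiv` are the contributions of the points with `p, q > 0`, with `p = 0`,
and with `q = 0`, where the perspective is `q f(p / q)`, `f(0+) q` and `f'(∞) p` respectively. -/
lemma IsNonnegGenerator.fDiv_eq {f : ℝ → ℝ} (hf : IsNonnegGenerator f)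
    (P Q : Measure α) [IsFiniteMeasure P] [IsFiniteMeasure Q] :
    fDiv f P Q = (eDiv f P Q : EReal) := by
  have hm : MeasurableSet {x | P.rnDeriv Q x ≠ 0} :=
    ((Measure.measurable_rnDeriv P Q) (measurableSet_singleton 0)).compl
  have hc : {x | P.rnDeriv Q x ≠ 0}ᶜ = {x | P.rnDeriv Q x = 0} := by ext; simp
  rw [fDiv, hf.densityIntegral_eq, eDiv_eq_rnDeriv,
    ← lintegral_add_compl (fun x => persp f (P.rnDeriv Q x) 1) hm,
    EReal.coe_ennreal_add, EReal.coe_ennreal_add]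
  congr 1
  · congr 1
    · congr 1
      refine lintegral_congr_ae ?_
      filter_upwards [ae_restrict_mem hm, ae_restrict_of_ae (Measure.rnDeriv_lt_top P Q)]
        with x hx hx'
      rw [hf.persp_of_pos hx'.ne (by simp) hx (by simp), div_one, one_mul]
    · have : ∫⁻ x in {x | P.rnDeriv Q x ≠ 0}ᶜ, persp f (P.rnDeriv Q x) 1 ∂Q
          = ∫⁻ x in {x | P.rnDeriv Q x ≠ 0}ᶜ, (valueAtZero f).toENNReal ∂Q := by
        refine lintegral_congr_ae ?_
        filter_upwards [ae_restrict_mem hm.compl] with x hx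
        have hx : P.rnDeriv Q x = 0 := by simpa using hx
        rw [hx, hf.persp_zero_left (by simp), mul_one]
      rw [this, setLIntegral_const, hc, EReal.coe_ennreal_mul,
        EReal.coe_toENNReal hf.valueAtZero_nonneg]
  · rw [hf.persp_zero_right (by simp), mul_one, EReal.coe_ennreal_mul,
      EReal.coe_toENNReal hf.slopeAtTop_nonneg]

end

/-! ### Reduction to nonnegative generators. -/

/-- Subtracting a multiple of `t - 1`. -/
def shift (f : ℝ → ℝ) (c : ℝ) : ℝ → ℝ := fun t => f t - c * (t - 1)

lemma IsGenerator.shift {f : ℝ → ℝ} (hf : IsGenerator f) (c : ℝ) : IsGenerator (shift f c) where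
  convexOn := by
    refine hf.convexOn.sub ⟨convex_Ioi 0, fun x _ y _ a b _ _ hab => le_of_eq ?_⟩
    simp only [smul_eq_mul]
    linear_combination -c * hab
  map_one := by simp [_root_.shift, hf.map_one]

lemma IsGenerator.exists_shift {f : ℝ → ℝ} (hf : IsGenerator f) :
    ∃ c, IsNonnegGenerator (_root_.shift f c) := by
  obtain ⟨c, hc⟩ := hf.convexOn.exists_isMinorant one_pos
  refine ⟨c, hf.shift c, fun t ht => ?_⟩
  have := hc t ht
  rw [hf.map_one] at this
  simp only [_root_.shift]
  linarith

lemma shift_shift_neg (f : ℝ → ℝ) (c : ℝ) : shift (shift f c) (-c) = f := by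
  ext t; simp [shift]

lemma EReal.limsup_add_coe_le {ι : Type*} {l : Filter ι} [l.NeBot] {u : ι → EReal} {v : ι → ℝ}
    {c : ℝ} (hv : Tendsto v l (𝓝 c)) :
    limsup (fun i => u i + (v i : EReal)) l ≤ limsup u l + (c : EReal) := by
  have h : limsup (fun i => (v i : EReal)) l = (c : EReal) :=
    ((continuous_coe_real_ereal.tendsto c).comp hv).limsup_eq
  rw [← h]
  exact EReal.limsup_add_le (by simp [h]) (by simp [h])

/-- Only one inequality is needed for the limits of a shifted generator: the reverse one is the same
statement for the shift by `-c`. -/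
lemma valueAtZero_shift_le (f : ℝ → ℝ) (c : ℝ) :
    valueAtZero (shift f c) ≤ valueAtZero f + (c : EReal) := by
  have h : Tendsto (fun t : ℝ => -(c * (t - 1))) (𝓝[>] 0) (𝓝 c) := by
    have : ContinuousAt (fun t : ℝ => -(c * (t - 1))) 0 := by fun_prop
    simpa [ContinuousAt] using this.tendsto.mono_left nhdsWithin_le_nhds
  refine le_trans (le_of_eq ?_) (EReal.limsup_add_coe_le h)
  simp only [valueAtZero, shift, ← EReal.coe_add, sub_eq_add_neg]

lemma slopeAtTop_shift_le (f : ℝ → ℝ) (c : ℝ) :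
    slopeAtTop (shift f c) ≤ slopeAtTop f + ((-c : ℝ) : EReal) := by
  have h : Tendsto (fun t : ℝ => -c + c / t) atTop (𝓝 (-c)) := by
    simpa using (tendsto_const_nhds (x := -c)).add
      (tendsto_const_nhds.div_atTop tendsto_id (a := c))
  refine le_trans (le_of_eq ?_) (EReal.limsup_add_coe_le h)
  refine limsup_congr ?_
  filter_upwards [eventually_gt_atTop 0] with t ht
  rw [← EReal.coe_add, shift]
  congr 1
  field_simp
  ring

lemma EReal.eq_add_coe_of_le {x y : EReal} {c : ℝ} (h1 : x ≤ y + c) (h2 : y ≤ x + (-c : ℝ)) :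
    x = y + c := by
  refine le_antisymm h1 ?_
  calc y + c ≤ x + (-c : ℝ) + c := by gcongr
    _ = x := by
      rw [add_assoc, ← EReal.coe_add, neg_add_cancel, EReal.coe_zero, add_zero]

lemma valueAtZero_shift (f : ℝ → ℝ) (c : ℝ) :
    valueAtZero (shift f c) = valueAtZero f + (c : EReal) :=
  EReal.eq_add_coe_of_le (valueAtZero_shift_le f c) <| by
    simpa [shift_shift_neg] using valueAtZero_shift_le (shift f c) (-c)

lemma slopeAtTop_shift (f : ℝ → ℝ) (c : ℝ) :
    slopeAtTop (shift f c) = slopeAtTop f + ((-c : ℝ) : EReal) :=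
  EReal.eq_add_coe_of_le (slopeAtTop_shift_le f c) <| by
    simpa [shift_shift_neg] using slopeAtTop_shift_le (shift f c) (-c)

section

variable {α : Type*} [MeasurableSpace α]

lemma densityIntegral_shift (f : ℝ → ℝ) (c : ℝ) (P Q : Measure α) [IsFiniteMeasure P]
    [IsFiniteMeasure Q] :
    densityIntegral (shift f c) P Q = densityIntegral f P Q
      + ((-c * ∫ x in {x | P.rnDeriv Q x ≠ 0}, ((P.rnDeriv Q x).toReal - 1) ∂Q : ℝ) : EReal) := by
  have hi : IntegrableOn (fun x => (P.rnDeriv Q x).toReal - 1) {x | P.rnDeriv Q x ≠ 0} Q :=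
    (Measure.integrable_toReal_rnDeriv.sub (integrable_const 1)).integrableOn
  have hi' := hi.const_mul c
  unfold densityIntegral
  by_cases h : IntegrableOn (fun x => f (P.rnDeriv Q x).toReal) {x | P.rnDeriv Q x ≠ 0} Q
  · have h2 : IntegrableOn (fun x => shift f c (P.rnDeriv Q x).toReal)
      {x | P.rnDeriv Q x ≠ 0} Q := h.sub hi'
    rw [if_pos h, if_pos h2, ← EReal.coe_add, neg_mul, ← integral_const_mul, ← sub_eq_add_neg,
      ← integral_sub h hi']
    rfl
  · have h2 : ¬ IntegrableOn (fun x => shift f c (P.rnDeriv Q x).toReal)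
      {x | P.rnDeriv Q x ≠ 0} Q := fun h2 => h <| by
        refine (h2.add hi').congr ?_
        filter_upwards with x
        simp [shift]
    rw [if_neg h, if_neg h2, EReal.top_add_coe]

lemma fDiv_shift (f : ℝ → ℝ) (c : ℝ) (P Q : Measure α) [IsProbabilityMeasure P]
    [IsProbabilityMeasure Q] : fDiv (shift f c) P Q = fDiv f P Q := by
  have hm : MeasurableSet {x | P.rnDeriv Q x ≠ 0} :=
    ((Measure.measurable_rnDeriv P Q) (measurableSet_singleton 0)).compl
  have hc : {x | P.rnDeriv Q x ≠ 0}ᶜ = {x | P.rnDeriv Q x = 0} := by ext; simp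
  have hi : Integrable (fun x => (P.rnDeriv Q x).toReal - 1) Q :=
    Measure.integrable_toReal_rnDeriv.sub (integrable_const 1)
  -- Over the whole space the integral is `-P_s`, as `P` and `Q` have the same mass; the set where
  -- the density vanishes contributes `-Q{dP/dQ = 0}`. The corrections of the three summands
  -- therefore cancel.
  have e1 : ∫ x in {x | P.rnDeriv Q x ≠ 0}, ((P.rnDeriv Q x).toReal - 1) ∂Q
      = Q.real {x | P.rnDeriv Q x = 0} - (P.singularPart Q).real univ := by
    have h1 := integral_add_compl hm hi
    have h2 : ∫ x in {x | P.rnDeriv Q x ≠ 0}ᶜ, ((P.rnDeriv Q x).toReal - 1) ∂Q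
        = - Q.real {x | P.rnDeriv Q x = 0} := by
      rw [setIntegral_congr_fun hm.compl (g := fun _ => (-1 : ℝ)), setIntegral_const, hc]
      · simp
      · intro x hx
        have hx : P.rnDeriv Q x = 0 := by simpa using hx
        simp [hx]
    have h3 : ∫ x, ((P.rnDeriv Q x).toReal - 1) ∂Q = - (P.singularPart Q).real univ := by
      rw [integral_sub Measure.integrable_toReal_rnDeriv (integrable_const 1),
        Measure.integral_toReal_rnDeriv']
      simp
    linarith
  have hA : ((Q {x | P.rnDeriv Q x = 0} : ℝ≥0∞) : EReal)
      = ((Q.real {x | P.rnDeriv Q x = 0} : ℝ) : EReal) :=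
    (EReal.coe_ennreal_toReal (measure_ne_top _ _)).symm
  have hB : ((P.singularPart Q univ : ℝ≥0∞) : EReal)
      = (((P.singularPart Q).real univ : ℝ) : EReal) :=
    (EReal.coe_ennreal_toReal (measure_ne_top _ _)).symm
  have d : ∀ (v : EReal) (x y : ℝ), 0 ≤ y → (v + (x : EReal)) * (y : EReal)
      = v * y + ((x * y : ℝ) : EReal) := fun v x y hy => by
    rw [EReal.right_distrib_of_nonneg_of_ne_top (EReal.coe_nonneg.2 hy) (EReal.coe_ne_top y),
      EReal.coe_mul]
  rw [fDiv, fDiv, densityIntegral_shift, valueAtZero_shift, slopeAtTop_shift, hA, hB,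
    d _ _ _ measureReal_nonneg, d _ _ _ measureReal_nonneg, e1]
  set a := Q.real {x | P.rnDeriv Q x = 0}
  set b := (P.singularPart Q).real univ
  set D := densityIntegral f P Q
  set V := valueAtZero f * (a : EReal)
  set S := slopeAtTop f * (b : EReal)
  have : ((-c * (a - b) : ℝ) : EReal) + ((c * a : ℝ) : EReal) + ((-c * b : ℝ) : EReal) = 0 := by
    rw [← EReal.coe_add, ← EReal.coe_add, ← EReal.coe_zero]
    congr 1
    ring
  calc D + ((-c * (a - b) : ℝ) : EReal) + (V + ((c * a : ℝ) : EReal))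
        + (S + ((-c * b : ℝ) : EReal))
      = D + V + S + (((-c * (a - b) : ℝ) : EReal) + ((c * a : ℝ) : EReal)
        + ((-c * b : ℝ) : EReal)) := by abel
    _ = D + V + S := by rw [this, add_zero]

end

/-! ### Data processing and joint convexity. -/

section

variable {α β : Type*} [MeasurableSpace α] [MeasurableSpace β]

lemma withDensity_sup_le {μ ν : Measure α} {h k : α → ℝ≥0∞} (hh : Measurable h)
    (hk : Measurable k) (h1 : μ.withDensity h ≤ ν) (h2 : μ.withDensity k ≤ ν) :
    μ.withDensity (h ⊔ k) ≤ ν := by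
  refine Measure.le_iff.2 fun A hA => ?_
  have hS : MeasurableSet {x | h x ≤ k x} := measurableSet_le hh hk
  rw [withDensity_apply _ hA, ← lintegral_inter_add_sdiff _ A hS,
    ← measure_inter_add_sdiff A hS]
  refine add_le_add ?_ ?_
  · refine le_trans (le_of_eq ?_) (h2 _)
    rw [withDensity_apply _ (hA.inter hS)]
    exact setLIntegral_congr_fun (hA.inter hS) fun x hx => sup_eq_right.2 hx.2
  · refine le_trans (le_of_eq ?_) (h1 _)
    rw [withDensity_apply _ (hA.diff hS)]
    exact setLIntegral_congr_fun (hA.diff hS) fun x hx => sup_eq_left.2 (le_of_not_ge hx.2)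

/-- Two densities are handled by splitting the set according to which is larger, and countably many
by monotone convergence of the partial suprema. Applied to the minorants that define the
perspective, this takes the place of a conditional Jensen inequality. -/
lemma withDensity_iSup_le {ι : Type*} [Countable ι] {μ ν : Measure α} {h : ι → α → ℝ≥0∞}
    (hh : ∀ i, Measurable (h i)) (hle : ∀ i, μ.withDensity (h i) ≤ ν) :
    μ.withDensity (fun x => ⨆ i, h i x) ≤ ν := by
  rcases isEmpty_or_nonempty ι with hι | hι
  · simpa using Measure.zero_le ν
  obtain ⟨e, he⟩ := exists_surjective_nat ι
  set k : ℕ → α → ℝ≥0∞ := fun n => partialSups (fun n => h (e n)) n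
  have hk : ∀ n, Measurable (k n) ∧ μ.withDensity (k n) ≤ ν := by
    intro n
    induction n with
    | zero => simpa [k] using ⟨hh _, hle _⟩
    | succ n ih =>
      have : k (n + 1) = k n ⊔ h (e (n + 1)) := partialSups_add_one _ _
      rw [this]
      exact ⟨ih.1.sup (hh _), withDensity_sup_le ih.1 (hh _) ih.2 (hle _)⟩
  have hsup : (fun x => ⨆ i, h i x) = fun x => ⨆ n, k n x := by
    have h1 : (⨆ n, k n) = ⨆ n, h (e n) := iSup_partialSups_eq _
    ext x
    rw [← iSup_apply, ← he.iSup_comp, ← h1, iSup_apply]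
  rw [hsup]
  refine Measure.le_iff.2 fun A hA => ?_
  rw [withDensity_apply _ hA, lintegral_iSup (fun n => (hk n).1) (partialSups _).monotone]
  refine iSup_le fun n => ?_
  rw [← withDensity_apply _ hA]
  exact (hk n).2 A

lemma withDensity_affine (μ : Measure α) (a b : ℝ≥0∞) {p q : α → ℝ≥0∞} (hp : Measurable p)
    (hq : Measurable q) : μ.withDensity (fun x => a * p x + b * q x)
      = a • μ.withDensity p + b • μ.withDensity q := by
  rw [← withDensity_smul _ hp, ← withDensity_smul _ hq,
    ← withDensity_add_left (hp.const_smul a)]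
  rfl

/-- The data processing inequality. -/
lemma eDiv_map_le (f : ℝ → ℝ) (P Q : Measure α) [IsFiniteMeasure P] [IsFiniteMeasure Q]
    {g : α → β} (hg : Measurable g) : eDiv f (P.map g) (Q.map g) ≤ eDiv f P Q := by
  set μ := P + Q with hμ
  set p := P.rnDeriv μ
  set q := Q.rnDeriv μ
  have hp : Measurable p := Measure.measurable_rnDeriv _ _
  have hq : Measurable q := Measure.measurable_rnDeriv _ _
  have hP : μ.withDensity p = P := Measure.withDensity_rnDeriv_eq _ _
    (Measure.le_add_right le_rfl).absolutelyContinuous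
  have hQ : μ.withDensity q = Q := Measure.withDensity_rnDeriv_eq _ _
    (Measure.le_add_left le_rfl).absolutelyContinuous
  set P' := P.map g
  set Q' := Q.map g
  set μ' := P' + Q' with hμ'
  set p' := P'.rnDeriv μ'
  set q' := Q'.rnDeriv μ'
  have hp' : Measurable p' := Measure.measurable_rnDeriv _ _
  have hq' : Measurable q' := Measure.measurable_rnDeriv _ _
  have hP' : μ'.withDensity p' = P' := Measure.withDensity_rnDeriv_eq _ _
    (Measure.le_add_right le_rfl).absolutelyContinuous
  have hQ' : μ'.withDensity q' = Q' := Measure.withDensity_rnDeriv_eq _ _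
    (Measure.le_add_left le_rfl).absolutelyContinuous
  have hΦ : Measurable fun x => persp f (p x) (q x) := hp.persp f hq
  set ν := (μ.withDensity fun x => persp f (p x) (q x)).map g
  -- It suffices to bound each minorant as a measure: linear combinations of `P` and `Q` commute
  -- with the pushforward, whereas the perspective does not.
  have key : ∀ c : RatMinorant f,
      μ'.withDensity (fun x => homAffine c.1.1 c.1.2 (p' x) (q' x)) ≤ ν := by
    intro c
    have hu : ∀ a b : ℝ≥0∞, μ'.withDensity (fun x => a * p' x + b * q' x)
        = (μ.withDensity fun x => a * p x + b * q x).map g := by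
      intro a b
      rw [withDensity_affine _ _ _ hp' hq', withDensity_affine _ _ _ hp hq, hP, hQ, hP', hQ',
        Measure.map_add _ _ hg, Measure.map_smul, Measure.map_smul]
    set v' : β → ℝ≥0∞ := fun x => ENNReal.ofReal (-c.1.1) * p' x + ENNReal.ofReal (-c.1.2) * q' x
    set u' : β → ℝ≥0∞ := fun x => ENNReal.ofReal c.1.1 * p' x + ENNReal.ofReal c.1.2 * q' x
    have hfin : IsFiniteMeasure (μ'.withDensity v') := by
      rw [withDensity_affine _ _ _ hp' hq', hP', hQ']
      have h1 : IsFiniteMeasure (ENNReal.ofReal (-c.1.1) • P') :=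
        Measure.smul_finite _ ENNReal.ofReal_ne_top
      have h2 : IsFiniteMeasure (ENNReal.ofReal (-c.1.2) • Q') :=
        Measure.smul_finite _ ENNReal.ofReal_ne_top
      infer_instance
    have hu' : Measurable u' := by fun_prop
    have hv' : Measurable v' := by fun_prop
    -- The truncated difference of densities gives the truncated difference of finite measures. It
    -- then remains to show that `u'` is at most `ν` plus `v'` as measures, which is the pushforward
    -- of a pointwise inequality upstairs.
    change μ'.withDensity (u' - v') ≤ ν
    rw [Measure.withDensity_sub hu' hv']
    refine Measure.sub_le_of_le_add ?_
    rw [hu, hu, ← Measure.map_add _ _ hg, ← withDensity_add_left hΦ]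
    refine Measure.map_mono (withDensity_mono (ae_of_all _ fun x => ?_)) hg
    exact tsub_le_iff_right.1
      (le_iSup (fun c : RatMinorant f => homAffine c.1.1 c.1.2 (p x) (q x)) c)
  have h := withDensity_iSup_le (fun c : RatMinorant f =>
    (measurable_homAffine c.1.1 c.1.2).comp (hp'.prodMk hq')) key univ
  rw [withDensity_apply _ MeasurableSet.univ, Measure.restrict_univ,
    Measure.map_apply hg MeasurableSet.univ, preimage_univ, withDensity_apply _ MeasurableSet.univ,
    Measure.restrict_univ] at h
  exact h

lemma eDiv_eq_of_ac (f : ℝ → ℝ) (P Q μ : Measure α) [IsFiniteMeasure P] [IsFiniteMeasure Q]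
    [IsFiniteMeasure μ] (hP : P ≪ μ) (hQ : Q ≪ μ) :
    eDiv f P Q = ∫⁻ x, persp f (P.rnDeriv μ x) (Q.rnDeriv μ x) ∂μ := by
  have h1 := Measure.withDensity_rnDeriv_eq _ _ hP
  have h2 := Measure.withDensity_rnDeriv_eq _ _ hQ
  have h3 : IsFiniteMeasure (μ.withDensity (P.rnDeriv μ)) := h1.symm ▸ ‹_›
  have h4 : IsFiniteMeasure (μ.withDensity (Q.rnDeriv μ)) := h2.symm ▸ ‹_›
  have h := eDiv_withDensity f μ (Measure.measurable_rnDeriv P μ) (Measure.measurable_rnDeriv Q μ)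
  rwa [h1, h2] at h

/-- Joint convexity (in the homogeneous form of subadditivity). -/
lemma eDiv_sum_le {ι : Type*} [Fintype ι] (f : ℝ → ℝ) (P Q : ι → Measure α)
    [∀ i, IsFiniteMeasure (P i)] [∀ i, IsFiniteMeasure (Q i)] :
    eDiv f (∑ i, P i) (∑ i, Q i) ≤ ∑ i, eDiv f (P i) (Q i) := by
  set μ := ∑ i, (P i + Q i) with hμ
  have hle : ∀ i, P i + Q i ≤ μ := fun i =>
    Finset.single_le_sum (f := fun i => P i + Q i) (fun _ _ => Measure.zero_le _)
      (Finset.mem_univ i)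
  have hP : ∀ i, P i ≪ μ := fun i =>
    ((Measure.le_add_right le_rfl).trans (hle i)).absolutelyContinuous
  have hQ : ∀ i, Q i ≪ μ := fun i =>
    ((Measure.le_add_left le_rfl).trans (hle i)).absolutelyContinuous
  have hs : ∀ R : ι → Measure α, (∀ i, IsFiniteMeasure (R i)) → (∀ i, R i ≪ μ) →
      ∑ i, R i = μ.withDensity (fun x => ∑ i, (R i).rnDeriv μ x) := by
    intro R _ hR
    ext A hA
    rw [withDensity_apply _ hA, lintegral_finsetSum _ fun i _ => Measure.measurable_rnDeriv _ _,
      Measure.finsetSum_apply]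
    exact Finset.sum_congr rfl fun i _ => (Measure.setLIntegral_rnDeriv (hR i) A).symm
  have h1 := hs P inferInstance hP
  have h2 := hs Q inferInstance hQ
  have h3 : IsFiniteMeasure (μ.withDensity fun x => ∑ i, (P i).rnDeriv μ x) := h1 ▸ inferInstance
  have h4 : IsFiniteMeasure (μ.withDensity fun x => ∑ i, (Q i).rnDeriv μ x) := h2 ▸ inferInstance
  have hmeas : ∀ R : ι → Measure α, Measurable fun x => ∑ i, (R i).rnDeriv μ x := fun R =>
    Finset.measurable_sum _ fun i _ => Measure.measurable_rnDeriv _ _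
  have h := eDiv_withDensity f μ (hmeas P) (hmeas Q)
  rw [← h1, ← h2] at h
  rw [h, Finset.sum_congr rfl fun i _ => eDiv_eq_of_ac f (P i) (Q i) μ (hP i) (hQ i),
    ← lintegral_finsetSum _ fun i _ =>
      (Measure.measurable_rnDeriv _ _).persp f (Measure.measurable_rnDeriv _ _)]
  exact lintegral_mono fun x => persp_sum_le _ _ _ _

lemma eDiv_withDensity_withDensity (f : ℝ → ℝ) (P Q : Measure α) [IsFiniteMeasure P]
    [IsFiniteMeasure Q] {g : α → ℝ≥0∞} (hg : Measurable g) (hg1 : ∀ x, g x ≤ 1) :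
    eDiv f (P.withDensity g) (Q.withDensity g)
      = ∫⁻ x, g x * persp f (P.rnDeriv (P + Q) x) (Q.rnDeriv (P + Q) x) ∂(P + Q) := by
  have hfin : ∀ R : Measure α, IsFiniteMeasure R → IsFiniteMeasure (R.withDensity g) :=
    fun R _ => isFiniteMeasure_withDensity ((lintegral_mono hg1).trans_lt (by simp)).ne
  have e : ∀ R : Measure α, IsFiniteMeasure R → R ≪ P + Q →
      (P + Q).withDensity (g * R.rnDeriv (P + Q)) = R.withDensity g := by
    intro R _ hR
    rw [mul_comm, withDensity_mul _ (Measure.measurable_rnDeriv _ _) hg,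
      Measure.withDensity_rnDeriv_eq _ _ hR]
  have h1 := e P inferInstance (Measure.le_add_right le_rfl).absolutelyContinuous
  have h2 := e Q inferInstance (Measure.le_add_left le_rfl).absolutelyContinuous
  have h3 : IsFiniteMeasure ((P + Q).withDensity (g * P.rnDeriv (P + Q))) :=
    h1 ▸ hfin P inferInstance
  have h4 : IsFiniteMeasure ((P + Q).withDensity (g * Q.rnDeriv (P + Q))) :=
    h2 ▸ hfin Q inferInstance
  have h := eDiv_withDensity f (P + Q) (hg.mul (Measure.measurable_rnDeriv P (P + Q)))
    (hg.mul (Measure.measurable_rnDeriv Q (P + Q)))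
  rw [h1, h2] at h
  rw [h]
  refine lintegral_congr fun x => ?_
  rw [Pi.mul_apply, Pi.mul_apply, persp_mul f ((hg1 x).trans_lt ENNReal.one_lt_top).ne]

/-- Weighting both measures by the same density multiplies the integrand by it, by homogeneity. This
reverses joint convexity when the pieces are cut out by common densities. -/
lemma sum_eDiv_withDensity_le {ι : Type*} [Fintype ι] (f : ℝ → ℝ) (P Q : Measure α)
    [IsFiniteMeasure P] [IsFiniteMeasure Q] {g : ι → α → ℝ≥0∞} (hg : ∀ i, Measurable (g i))
    (hg1 : ∀ x, ∑ i, g i x ≤ 1) :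
    ∑ i, eDiv f (P.withDensity (g i)) (Q.withDensity (g i)) ≤ eDiv f P Q := by
  have h1 : ∀ i x, g i x ≤ 1 := fun i x =>
    (Finset.single_le_sum (f := fun i => g i x) (fun _ _ => zero_le) (Finset.mem_univ i)).trans
      (hg1 x)
  have hΦ := (Measure.measurable_rnDeriv P (P + Q)).persp f (Measure.measurable_rnDeriv Q (P + Q))
  rw [Finset.sum_congr rfl fun i _ => eDiv_withDensity_withDensity f P Q (hg i) (h1 i),
    ← lintegral_finsetSum Finset.univ (f := fun i x => g i x * persp f (P.rnDeriv (P + Q) x)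
      (Q.rnDeriv (P + Q) x)) fun i _ => (hg i).mul hΦ]
  refine lintegral_mono fun x => ?_
  simp only
  rw [← Finset.sum_mul]
  exact mul_le_of_le_one_left zero_le (hg1 x)

lemma eDiv_smul (f : ℝ → ℝ) (P Q : Measure α) [IsFiniteMeasure P] [IsFiniteMeasure Q] (c : ℝ≥0) :
    eDiv f (c • P) (c • Q) = c * eDiv f P Q := by
  set μ := P + Q with hμ
  have hP : P ≪ μ := (Measure.le_add_right le_rfl).absolutelyContinuous
  have hQ : Q ≪ μ := (Measure.le_add_left le_rfl).absolutelyContinuous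
  rw [eDiv_eq_of_ac f (c • P) (c • Q) μ (hP.smul_left c) (hQ.smul_left c), eDiv,
    ← lintegral_const_mul' _ _ ENNReal.coe_ne_top]
  refine lintegral_congr_ae ?_
  filter_upwards [Measure.rnDeriv_smul_left_of_ne_top P μ (r := c) ENNReal.coe_ne_top,
    Measure.rnDeriv_smul_left_of_ne_top Q μ (r := c) ENNReal.coe_ne_top] with x h1 h2
  rw [← persp_mul f ENNReal.coe_ne_top]
  congr 1

lemma IsNonnegGenerator.eDiv_self {f : ℝ → ℝ} (hf : IsNonnegGenerator f) (P : Measure α)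
    [IsFiniteMeasure P] : eDiv f P P = 0 := by
  rw [eDiv_eq_of_ac f P P P Measure.AbsolutelyContinuous.rfl Measure.AbsolutelyContinuous.rfl,
    lintegral_eq_zero_iff ((Measure.measurable_rnDeriv _ _).persp f
      (Measure.measurable_rnDeriv _ _))]
  filter_upwards [Measure.rnDeriv_self P] with x hx
  rw [hx, hf.persp_of_pos (by simp) (by simp) (by simp) (by simp)]
  simp [hf.map_one]

lemma eDiv_snd_le (f : ℝ → ℝ) (ρ : Measure (α × β)) [IsFiniteMeasure ρ] (P : Measure α)
    [IsProbabilityMeasure P] (Q : Measure β) [IsFiniteMeasure Q] :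
    eDiv f ρ.snd Q ≤ eDiv f ρ (P.prod Q) := by
  have h := eDiv_map_le f ρ (P.prod Q) measurable_snd
  have e : (P.prod Q).map Prod.snd = Q := by
    exact Measure.snd_prod (μ := P) (ν := Q)
  rwa [e] at h

end

/-! ### The three informations as extended nonnegative numbers. -/

section

variable {α β : Type*} [MeasurableSpace α] [MeasurableSpace β]

/-- The index set of the infimum in the information of Polyanskiy and Verdú. -/
abbrev PVIndex (ρ : Measure (α × β)) : Type _ :=
  {Q : Measure β // IsProbabilityMeasure Q ∧ ρ.snd ≪ Q}

/-- The index set of the infimum in the MBGYA information. -/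
abbrev MBGYAIndex (f : ℝ → ℝ) (ρ : Measure (α × β)) : Type _ :=
  {Q : Measure β // IsProbabilityMeasure Q ∧ ρ.snd ≪ Q ∧ eDiv f ρ.snd Q ≠ ∞}

/-- `I_f^CKZ` as an extended nonnegative number. -/
noncomputable def eCKZ (f : ℝ → ℝ) (ρ : Measure (α × β)) : ℝ≥0∞ :=
  eDiv f ρ (ρ.fst.prod ρ.snd)

/-- `I_f^PV` as an extended nonnegative number. -/
noncomputable def ePV (f : ℝ → ℝ) (ρ : Measure (α × β)) : ℝ≥0∞ :=
  ⨅ Q : PVIndex ρ, eDiv f ρ (ρ.fst.prod Q.1)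

/-- `I_f^MBGYA` as an extended nonnegative number. -/
noncomputable def eMBGYA (f : ℝ → ℝ) (ρ : Measure (α × β)) : ℝ≥0∞ :=
  ⨅ Q : MBGYAIndex f ρ, (eDiv f ρ (ρ.fst.prod Q.1) - eDiv f ρ.snd Q.1)

lemma EReal.coe_ennreal_iInf {ι : Sort*} (a : ι → ℝ≥0∞) :
    ((⨅ i, a i : ℝ≥0∞) : EReal) = ⨅ i, (a i : EReal) := by
  refine le_antisymm (le_iInf fun i => EReal.coe_ennreal_le_coe_ennreal_iff.2 (iInf_le _ i)) ?_
  have h0 : (0 : EReal) ≤ ⨅ i, (a i : EReal) := le_iInf fun i => EReal.coe_ennreal_nonneg _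
  rw [← EReal.coe_toENNReal h0, EReal.coe_ennreal_le_coe_ennreal_iff]
  refine le_iInf fun i => ?_
  rw [← EReal.coe_ennreal_le_coe_ennreal_iff, EReal.coe_toENNReal h0]
  exact iInf_le _ i

variable {f : ℝ → ℝ} {c : ℝ}

lemma IsNonnegGenerator.fDiv_eq_of_shift (hf : IsNonnegGenerator (shift f c)) (P Q : Measure α)
    [IsProbabilityMeasure P] [IsProbabilityMeasure Q] :
    fDiv f P Q = (eDiv (shift f c) P Q : EReal) := by
  rw [← fDiv_shift f c, hf.fDiv_eq]

lemma IsNonnegGenerator.infoCKZ_eq (hf : IsNonnegGenerator (shift f c)) (ρ : Measure (α × β))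
    [IsProbabilityMeasure ρ] : infoCKZ f ρ = (eCKZ (shift f c) ρ : EReal) :=
  hf.fDiv_eq_of_shift _ _

lemma IsNonnegGenerator.infoPV_eq (hf : IsNonnegGenerator (shift f c)) (ρ : Measure (α × β))
    [IsProbabilityMeasure ρ] : infoPV f ρ = (ePV (shift f c) ρ : EReal) := by
  rw [ePV, EReal.coe_ennreal_iInf, infoPV]
  refine le_antisymm (le_iInf fun ⟨Q, h1, h2⟩ => ?_)
    (le_iInf fun Q => le_iInf fun h1 => le_iInf fun h2 => ?_)
  · refine (iInf_le_of_le Q (iInf_le_of_le h1 (iInf_le _ h2))).trans_eq ?_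
    exact hf.fDiv_eq_of_shift _ _
  · refine (iInf_le _ (⟨Q, h1, h2⟩ : PVIndex ρ)).trans_eq ?_
    exact (hf.fDiv_eq_of_shift _ _).symm

/-- The truncated subtraction in `eMBGYA` is a genuine one, because `D(P_B ‖ Q) ≤ D(P_AB ‖ P_A × Q)`
by data processing. -/
lemma IsNonnegGenerator.infoMBGYA_eq (hf : IsNonnegGenerator (shift f c)) (ρ : Measure (α × β))
    [IsProbabilityMeasure ρ] : infoMBGYA f ρ = (eMBGYA (shift f c) ρ : EReal) := by
  have key : ∀ Q : Measure β, IsProbabilityMeasure Q → eDiv (shift f c) ρ.snd Q ≠ ∞ →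
      fDiv f ρ (ρ.fst.prod Q) - fDiv f ρ.snd Q
        = ((eDiv (shift f c) ρ (ρ.fst.prod Q) - eDiv (shift f c) ρ.snd Q : ℝ≥0∞) : EReal) := by
    intro Q _ h
    rw [hf.fDiv_eq_of_shift, hf.fDiv_eq_of_shift, ENNReal.toEReal_sub h (eDiv_snd_le _ _ _ _)]
  rw [eMBGYA, EReal.coe_ennreal_iInf, infoMBGYA]
  refine le_antisymm (le_iInf fun ⟨Q, h1, h2, h3⟩ => ?_)
    (le_iInf fun Q => le_iInf fun h1 => le_iInf fun h2 => le_iInf fun h3 => ?_)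
  · have h3' : fDiv f ρ.snd Q ≠ ⊤ := by
      rwa [hf.fDiv_eq_of_shift, Ne, EReal.coe_ennreal_eq_top_iff]
    refine (iInf_le_of_le Q (iInf_le_of_le h1 (iInf_le_of_le h2 (iInf_le _ h3')))).trans_eq ?_
    exact key Q h1 h3
  · have h3' : eDiv (shift f c) ρ.snd Q ≠ ∞ := by
      rwa [hf.fDiv_eq_of_shift, Ne, EReal.coe_ennreal_eq_top_iff] at h3
    refine (iInf_le _ (⟨Q, h1, h2, h3'⟩ : MBGYAIndex _ ρ)).trans_eq ?_
    exact (key Q h1 h3').symm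

lemma EReal.coe_ennreal_finsetSum {ι : Type*} (s : Finset ι) (a : ι → ℝ≥0∞) :
    ((∑ q ∈ s, a q : ℝ≥0∞) : EReal) = ∑ q ∈ s, (a q : EReal) := by
  classical
  induction s using Finset.induction_on with
  | empty => simp
  | insert q s hq ih =>
    rw [Finset.sum_insert hq, Finset.sum_insert hq, EReal.coe_ennreal_add, ih]

lemma condInfo_eq_coe {ι : Type*} [Fintype ι] {I : Measure (α × β) → EReal}
    {J : Measure (α × β) → ℝ≥0∞} (w : ι → ℝ≥0) (ρ : ι → Measure (α × β))
    (h : ∀ q, I (ρ q) = (J (ρ q) : EReal)) :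
    condInfo I w ρ = ((∑ q, w q * J (ρ q) : ℝ≥0∞) : EReal) := by
  rw [condInfo, EReal.coe_ennreal_finsetSum]
  refine Finset.sum_congr rfl fun q _ => ?_
  rw [h, EReal.coe_ennreal_mul]
  rfl

/-- A weighted finite sum of infima may be tested on all simultaneous choices of the indices,
through choices that are optimal up to `ε / (W + 1)`. -/
lemma ENNReal.le_sum_mul_iInf {ι : Type*} [Fintype ι] {κ : ι → Type*} [∀ i, Nonempty (κ i)]
    (w : ι → ℝ≥0) (d : (i : ι) → κ i → ℝ≥0∞) {A : ℝ≥0∞}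
    (h : ∀ j : (i : ι) → κ i, A ≤ ∑ i, w i * d i (j i)) : A ≤ ∑ i, w i * ⨅ j, d i j := by
  have hch : ∀ ε : ℝ≥0, 0 < ε → ∀ i, ∃ j, d i j ≤ (⨅ j, d i j) + ε := by
    intro ε hε i
    by_cases ht : (⨅ j, d i j) = ∞
    · exact ⟨Classical.arbitrary _, by simp [ht]⟩
    · obtain ⟨j, hj⟩ := iInf_lt_iff.1
        (ENNReal.lt_add_right ht (ENNReal.coe_ne_zero.2 hε.ne'))
      exact ⟨j, hj.le⟩
  refine ENNReal.le_of_forall_pos_le_add fun ε hε _ => ?_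
  set W : ℝ≥0 := ∑ i, w i
  have hδ : 0 < ε / (W + 1) := by positivity
  choose j hj using hch _ hδ
  calc A ≤ ∑ i, w i * d i (j i) := h j
    _ ≤ ∑ i, w i * ((⨅ j, d i j) + (ε / (W + 1) : ℝ≥0)) := by gcongr with i; exact hj i
    _ = ∑ i, w i * (⨅ j, d i j) + (W * (ε / (W + 1)) : ℝ≥0) := by
      simp only [mul_add, Finset.sum_add_distrib, ← Finset.sum_mul, W]
      push_cast
      rfl
    _ ≤ _ := by
      gcongr
      rw [← mul_div_assoc, div_le_iff₀ (by positivity), mul_comm]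
      gcongr
      simp

lemma PVIndex.nonempty (ρ : Measure (α × β)) [IsProbabilityMeasure ρ] : Nonempty (PVIndex ρ) :=
  ⟨⟨ρ.snd, inferInstance, Measure.AbsolutelyContinuous.rfl⟩⟩

lemma IsNonnegGenerator.mbgyaIndex_nonempty (hf : IsNonnegGenerator f) (ρ : Measure (α × β))
    [IsProbabilityMeasure ρ] : Nonempty (MBGYAIndex f ρ) :=
  ⟨⟨ρ.snd, inferInstance, Measure.AbsolutelyContinuous.rfl, by simp [hf.eDiv_self]⟩⟩

/-! ### Mixtures: concavity in the input law, convexity of CKZ and PV in the channel. -/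

section mixtures

variable {ι : Type*} [Fintype ι] {w : ι → ℝ≥0}

lemma isProbabilityMeasure_sum_smul (hw : ∑ q, w q = 1) (P : ι → Measure α)
    [∀ q, IsProbabilityMeasure (P q)] : IsProbabilityMeasure (∑ q, w q • P q) :=
  ⟨by
    simp only [Measure.finsetSum_apply, Measure.smul_apply, measure_univ, ENNReal.smul_def,
      smul_eq_mul, mul_one]
    exact_mod_cast congrArg ((↑) : ℝ≥0 → ℝ≥0∞) hw⟩

lemma map_sum_smul (w : ι → ℝ≥0) (P : ι → Measure α) {g : α → β} (hg : Measurable g) :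
    (∑ q, w q • P q).map g = ∑ q, w q • (P q).map g := by
  ext A hA
  simp [Measure.map_apply hg hA]

lemma prod_sum_smul (w : ι → ℝ≥0) (P : Measure α) [IsProbabilityMeasure P] (Q : ι → Measure β)
    [∀ q, IsProbabilityMeasure (Q q)] :
    P.prod (∑ q, w q • Q q) = ∑ q, w q • P.prod (Q q) := by
  ext A hA
  rw [Measure.prod_apply hA]
  simp only [Measure.finsetSum_apply, Measure.smul_apply, Measure.prod_apply hA, ENNReal.smul_def,
    smul_eq_mul]
  rw [lintegral_finsetSum _ fun q _ => (measurable_measure_prodMk_left hA).const_mul _]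
  refine Finset.sum_congr rfl fun q _ => ?_
  rw [lintegral_const_mul _ (measurable_measure_prodMk_left hA)]

lemma sum_smul_absolutelyContinuous {P Q : ι → Measure α} (h : ∀ q, P q ≪ Q q) :
    ∑ q, w q • P q ≪ ∑ q, w q • Q q := by
  refine Measure.AbsolutelyContinuous.mk fun A _ hA => ?_
  simp only [Measure.finsetSum_apply, Measure.smul_apply, ENNReal.smul_def, smul_eq_mul,
    Finset.sum_eq_zero_iff, Finset.mem_univ, true_implies, mul_eq_zero] at hA ⊢
  exact fun q => (hA q).imp_right fun h0 => h q h0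

lemma absolutelyContinuous_of_sum_smul {P : ι → Measure α} {Q : Measure α}
    (h : ∑ q, w q • P q ≪ Q) {q : ι} (hq : w q ≠ 0) : P q ≪ Q := by
  refine Measure.AbsolutelyContinuous.mk fun A _ hA => ?_
  have := h hA
  simp only [Measure.finsetSum_apply, Measure.smul_apply, ENNReal.smul_def, smul_eq_mul,
    Finset.sum_eq_zero_iff, Finset.mem_univ, true_implies, mul_eq_zero] at this
  exact (this q).resolve_left (by simpa using hq)

lemma eDiv_sum_smul_le (f : ℝ → ℝ) (w : ι → ℝ≥0) (P Q : ι → Measure α)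
    [∀ q, IsFiniteMeasure (P q)] [∀ q, IsFiniteMeasure (Q q)] :
    eDiv f (∑ q, w q • P q) (∑ q, w q • Q q) ≤ ∑ q, w q * eDiv f (P q) (Q q) :=
  (eDiv_sum_le f (fun q => w q • P q) fun q => w q • Q q).trans_eq
    (Finset.sum_congr rfl fun _ _ => eDiv_smul f _ _ _)

lemma compProd_mixChannel (P : Measure α) [IsProbabilityMeasure P] (κ : ι → Kernel α β)
    [∀ q, IsMarkovKernel (κ q)] [IsMarkovKernel (mixChannel w κ)] :
    P ⊗ₘ mixChannel w κ = ∑ q, w q • (P ⊗ₘ κ q) := by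
  ext A hA
  have e : ∀ x, mixChannel w κ x = ∑ q, w q • κ q x := fun _ => rfl
  rw [Measure.compProd_apply hA]
  simp only [e, Measure.finsetSum_apply, Measure.smul_apply, Measure.compProd_apply hA,
    ENNReal.smul_def, smul_eq_mul]
  rw [lintegral_finsetSum _ fun q _ => (Kernel.measurable_kernel_prodMk_left hA).const_mul _]
  refine Finset.sum_congr rfl fun q _ => ?_
  rw [lintegral_const_mul _ (Kernel.measurable_kernel_prodMk_left hA)]

lemma isMarkovKernel_mixChannel (hw : ∑ q, w q = 1) (κ : ι → Kernel α β)
    [∀ q, IsMarkovKernel (κ q)] : IsMarkovKernel (mixChannel w κ) :=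
  ⟨fun x => isProbabilityMeasure_sum_smul hw fun q => κ q x⟩

lemma sum_smul_compProd (w : ι → ℝ≥0) (P : ι → Measure α) [∀ q, IsProbabilityMeasure (P q)]
    (κ : Kernel α β) [IsMarkovKernel κ] :
    (∑ q, w q • P q) ⊗ₘ κ = ∑ q, w q • (P q ⊗ₘ κ) := by
  ext A hA
  rw [Measure.compProd_apply hA, lintegral_finsetSum_measure]
  simp only [Measure.finsetSum_apply, Measure.smul_apply, Measure.compProd_apply hA]
  refine Finset.sum_congr rfl fun q _ => ?_
  rw [lintegral_smul_measure]

/-- The components of a mixture have densities with respect to it that add up to at most `1`. -/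
lemma exists_density_sum_le_one (P : ι → Measure α) [∀ q, IsFiniteMeasure (P q)] :
    ∃ g : ι → α → ℝ≥0∞, (∀ q, Measurable (g q)) ∧ (∀ x, ∑ q, g q x ≤ 1) ∧
      ∀ q, (∑ q, P q).withDensity (g q) = P q := by
  set μ := ∑ q, P q
  have hle : ∀ q, P q ≤ μ := fun q =>
    Finset.single_le_sum (f := P) (fun _ _ => Measure.zero_le _) (Finset.mem_univ q)
  have hm : ∀ q, Measurable ((P q).rnDeriv μ) := fun q => Measure.measurable_rnDeriv _ _
  have hms : Measurable fun x => ∑ q, (P q).rnDeriv μ x := Finset.measurable_sum _ fun q _ => hm q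
  -- The Radon-Nikodym derivatives add up to `1` only almost everywhere; setting them to `0` off `S`
  -- gives the bound at every point.
  set S := {x | ∑ q, (P q).rnDeriv μ x ≤ 1}
  have hS : MeasurableSet S := measurableSet_le hms measurable_const
  have hae : ∀ᵐ x ∂μ, ∑ q, (P q).rnDeriv μ x = 1 := by
    have h : μ.withDensity (fun x => ∑ q, (P q).rnDeriv μ x) = μ.withDensity 1 := by
      ext A hA
      rw [withDensity_apply _ hA, lintegral_finsetSum _ fun q _ => hm q, withDensity_one,
        Measure.finsetSum_apply]
      exact Finset.sum_congr rfl fun q _ =>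
        Measure.setLIntegral_rnDeriv (hle q).absolutelyContinuous A
    exact (withDensity_eq_iff_of_sigmaFinite hms.aemeasurable measurable_one.aemeasurable).1 h
  refine ⟨fun q => S.indicator ((P q).rnDeriv μ), fun q => (hm q).indicator hS, fun x => ?_,
    fun q => ?_⟩
  · by_cases hx : x ∈ S
    · simp only [indicator_of_mem hx]
      exact hx
    · simp [hx]
  · conv_rhs => rw [← Measure.withDensity_rnDeriv_eq _ _ (hle q).absolutelyContinuous]
    refine withDensity_congr_ae ?_
    filter_upwards [hae] with x hx
    have : x ∈ S := hx.le
    rw [indicator_of_mem this]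

lemma withDensity_compProd_left (P : Measure α) [IsFiniteMeasure P] (κ : Kernel α β)
    [IsMarkovKernel κ] {g : α → ℝ≥0∞} (hg : Measurable g) :
    (P ⊗ₘ κ).withDensity (fun z => g z.1) = P.withDensity g ⊗ₘ κ := by
  ext A hA
  have hm : Measurable fun a => κ a (Prod.mk a ⁻¹' A) := Kernel.measurable_kernel_prodMk_left hA
  have hg' : Measurable fun z : α × β => g z.1 := hg.comp measurable_fst
  rw [withDensity_apply _ hA, ← lintegral_indicator hA,
    Measure.lintegral_compProd (hg'.indicator hA), Measure.compProd_apply hA,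
    lintegral_withDensity_eq_lintegral_mul _ hg hm]
  refine lintegral_congr fun a => ?_
  have : ∀ b, A.indicator (fun z : α × β => g z.1) (a, b)
      = (Prod.mk a ⁻¹' A).indicator (fun _ => g a) b := fun _ => rfl
  simp only [Pi.mul_apply, this]
  rw [lintegral_indicator (measurable_prodMk_left hA), setLIntegral_const]

/-- For a fixed channel `κ` and a fixed `Q`, the divergence of `P ⊗ κ` from `P × Q` is concave
in `P`. -/
lemma sum_smul_eDiv_compProd_le (f : ℝ → ℝ) (w : ι → ℝ≥0) (P : ι → Measure α)
    [∀ q, IsProbabilityMeasure (P q)] (κ : Kernel α β) [IsMarkovKernel κ] (Q : Measure β)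
    [IsProbabilityMeasure Q] :
    ∑ q, w q * eDiv f (P q ⊗ₘ κ) ((P q).prod Q)
      ≤ eDiv f ((∑ q, w q • P q) ⊗ₘ κ) ((∑ q, w q • P q).prod Q) := by
  obtain ⟨g, hg, hg1, hgP⟩ := exists_density_sum_le_one fun q => w q • P q
  have e : ∀ (η : Kernel α β) [IsMarkovKernel η] (q : ι),
      ((∑ q, w q • P q) ⊗ₘ η).withDensity (fun z => g q z.1) = w q • (P q ⊗ₘ η) := by
    intro η _ q
    rw [withDensity_compProd_left _ _ (hg q), hgP]
    exact Measure.compProd_smul_left (w q : ℝ≥0∞)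
  -- Writing the product as a composition with a constant kernel, the same density, a function of
  -- the first coordinate, cuts out the `q`-th component of both measures.
  have h := sum_eDiv_withDensity_le f ((∑ q, w q • P q) ⊗ₘ κ)
    ((∑ q, w q • P q) ⊗ₘ Kernel.const α Q) (g := fun q z => g q z.1)
    (fun q => (hg q).comp measurable_fst) (fun z => hg1 z.1)
  simp only [e, eDiv_smul] at h
  simp only [Measure.compProd_const] at h
  exact h

lemma snd_sum_smul (w : ι → ℝ≥0) (ρ : ι → Measure (α × β)) :
    (∑ q, w q • ρ q).snd = ∑ q, w q • (ρ q).snd :=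
  map_sum_smul w ρ measurable_snd

lemma sum_ePV_le (f : ℝ → ℝ) (hw : ∑ q, w q = 1) (P : ι → Measure α)
    [∀ q, IsProbabilityMeasure (P q)] (κ : Kernel α β) [IsMarkovKernel κ] :
    ∑ q, w q * ePV f (P q ⊗ₘ κ) ≤ ePV f ((∑ q, w q • P q) ⊗ₘ κ) := by
  have := isProbabilityMeasure_sum_smul hw P
  refine le_iInf fun ⟨Q, hQ, hac⟩ => ?_
  rw [Measure.fst_compProd]
  refine le_trans (Finset.sum_le_sum fun q _ => ?_) (sum_smul_eDiv_compProd_le f w P κ Q)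
  rcases eq_or_ne (w q) 0 with h0 | h0
  · simp [h0]
  rw [sum_smul_compProd, snd_sum_smul] at hac
  gcongr
  refine (iInf_le _ (⟨Q, hQ, absolutelyContinuous_of_sum_smul hac h0⟩ : PVIndex _)).trans_eq ?_
  rw [Measure.fst_compProd]

/-- For each fixed `Q` the first divergence is concave in the input law, and the subtracted one,
`D(P_Y ‖ Q)`, is convex in it; an infimum of concave functions is concave. -/
lemma sum_eMBGYA_le (f : ℝ → ℝ) (hw : ∑ q, w q = 1) (P : ι → Measure α)
    [∀ q, IsProbabilityMeasure (P q)] (κ : Kernel α β) [IsMarkovKernel κ] :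
    ∑ q, w q * eMBGYA f (P q ⊗ₘ κ) ≤ eMBGYA f ((∑ q, w q • P q) ⊗ₘ κ) := by
  have := isProbabilityMeasure_sum_smul hw P
  refine le_iInf fun ⟨Q, hQ, hac, hd⟩ => ?_
  rw [Measure.fst_compProd]
  have hA := sum_smul_eDiv_compProd_le f w P κ Q
  set A := eDiv f ((∑ q, w q • P q) ⊗ₘ κ) ((∑ q, w q • P q).prod Q)
  have hdq := eDiv_sum_smul_le f w (fun q => (P q ⊗ₘ κ).snd) fun _ => Q
  have hQs : ∑ q, w q • Q = Q := by
    rw [← Finset.sum_smul, hw, one_smul]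
  rw [← snd_sum_smul, ← sum_smul_compProd, hQs] at hdq
  rcases eq_or_ne A ∞ with htop | htop
  · rw [htop, ENNReal.top_sub hd]
    exact le_top
  refine ENNReal.le_sub_of_add_le_right hd ?_
  refine le_trans (add_le_add_right hdq _) (le_trans ?_ hA)
  rw [← Finset.sum_add_distrib]
  refine Finset.sum_le_sum fun q _ => ?_
  rcases eq_or_ne (w q) 0 with h0 | h0
  · simp [h0]
  rw [sum_smul_compProd, snd_sum_smul] at hac
  have hle : eDiv f (P q ⊗ₘ κ).snd Q ≤ eDiv f (P q ⊗ₘ κ) ((P q).prod Q) := eDiv_snd_le _ _ _ _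
  -- Finiteness for the mixture passes to every component of positive weight, so that `Q` is
  -- admissible in the infimum for that component.
  have hfin : eDiv f (P q ⊗ₘ κ) ((P q).prod Q) ≠ ∞ := by
    intro h
    refine htop (top_le_iff.1 (le_trans ?_ hA))
    refine le_trans (le_of_eq ?_) (Finset.single_le_sum (f := fun q =>
      (w q : ℝ≥0∞) * eDiv f (P q ⊗ₘ κ) ((P q).prod Q)) (fun _ _ => zero_le) (Finset.mem_univ q))
    simp [h, h0]
  rw [← mul_add]
  gcongr
  refine le_trans (add_le_add_left (iInf_le _ (⟨Q, hQ, absolutelyContinuous_of_sum_smul hac h0,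
    (hle.trans_lt (lt_top_iff_ne_top.2 hfin)).ne⟩ : MBGYAIndex f _)) _) ?_
  rw [Measure.fst_compProd, tsub_add_cancel_of_le hle]

variable {ρ : ι → Measure (α × β)} {P : Measure α}

lemma fst_sum_smul_of_fst_eq (hw : ∑ q, w q = 1) (hP : ∀ q, (ρ q).fst = P) :
    (∑ q, w q • ρ q).fst = P := by
  refine (map_sum_smul w ρ measurable_fst).trans ?_
  have : ∀ q, (ρ q).map Prod.fst = P := hP
  simp only [this]
  rw [← Finset.sum_smul, hw, one_smul]

lemma eDiv_prod_sum_smul_le (f : ℝ → ℝ) (w : ι → ℝ≥0) [IsProbabilityMeasure P]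
    [∀ q, IsProbabilityMeasure (ρ q)] (Q : ι → Measure β) [∀ q, IsProbabilityMeasure (Q q)] :
    eDiv f (∑ q, w q • ρ q) (P.prod (∑ q, w q • Q q))
      ≤ ∑ q, w q * eDiv f (ρ q) (P.prod (Q q)) := by
  rw [prod_sum_smul]
  exact eDiv_sum_smul_le f w ρ fun q => P.prod (Q q)

lemma eCKZ_le_sum (f : ℝ → ℝ) (hw : ∑ q, w q = 1) [IsProbabilityMeasure P]
    [∀ q, IsProbabilityMeasure (ρ q)] (hP : ∀ q, (ρ q).fst = P) :
    eCKZ f (∑ q, w q • ρ q) ≤ ∑ q, w q * eCKZ f (ρ q) := by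
  simp only [eCKZ, hP]
  rw [fst_sum_smul_of_fst_eq hw hP, snd_sum_smul]
  exact eDiv_prod_sum_smul_le f w fun q => (ρ q).snd

lemma ePV_le_sum (f : ℝ → ℝ) (hw : ∑ q, w q = 1) [IsProbabilityMeasure P]
    [∀ q, IsProbabilityMeasure (ρ q)] (hP : ∀ q, (ρ q).fst = P) :
    ePV f (∑ q, w q • ρ q) ≤ ∑ q, w q * ePV f (ρ q) := by
  have := fun q => PVIndex.nonempty (ρ q)
  refine ENNReal.le_sum_mul_iInf w (fun q (Q : PVIndex (ρ q)) => eDiv f (ρ q) ((ρ q).fst.prod Q.1))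
    fun Q => ?_
  have hQ : ∀ q, IsProbabilityMeasure (Q q).1 := fun q => (Q q).2.1
  have hac : (∑ q, w q • ρ q).snd ≪ ∑ q, w q • (Q q).1 := by
    rw [snd_sum_smul]
    exact sum_smul_absolutelyContinuous fun q => (Q q).2.2
  refine (iInf_le _ (⟨_, isProbabilityMeasure_sum_smul hw fun q => (Q q).1, hac⟩ :
    PVIndex _)).trans ?_
  simp only [hP]
  rw [fst_sum_smul_of_fst_eq hw hP]
  exact eDiv_prod_sum_smul_le f w fun q => (Q q).1

end mixtures

end

/-! ### Analysis of the class: consequences of the concavity of `1 / f''`. -/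

lemma ConcaveOn.monotoneOn_of_pos {g : ℝ → ℝ} (hg : ConcaveOn ℝ (Ioi 0) g)
    (hpos : ∀ t, 0 < t → 0 < g t) : MonotoneOn g (Ioi 0) := by
  intro s hs t ht hst
  simp only [mem_Ioi] at hs ht
  rcases hst.eq_or_lt with rfl | hst
  · rfl
  by_contra! hlt
  have hgs := hpos s hs
  set l := (g s - g t) / g s with hl
  have hl0 : 0 < l := div_pos (by linarith) hgs
  have hl1 : l < 1 := by
    rw [hl, div_lt_one hgs]
    linarith [hpos t ht]
  -- At `u` the chord through `(s, g s)` and `(t, g t)` reaches zero. Concavity puts `g u` on or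
  -- below the chord, contradicting positivity.
  set u := s + (t - s) / l with hu
  have hu0 : 0 < u := by positivity [sub_pos.2 hst]
  have h := hg.2 (mem_Ioi.2 hs) (mem_Ioi.2 hu0) (show 0 ≤ 1 - l by linarith) hl0.le (by ring)
  have e : (1 - l) • s + l • u = t := by
    simp only [smul_eq_mul, hu]
    field_simp
    ring
  rw [e] at h
  simp only [smul_eq_mul] at h
  have e2 : l * g s = g s - g t := by rw [hl]; field_simp
  have := mul_pos hl0 (hpos u hu0)
  nlinarith

lemma ConcaveOn.mul_le_mul_of_pos {g : ℝ → ℝ} (hg : ConcaveOn ℝ (Ioi 0) g)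
    (hpos : ∀ t, 0 < t → 0 < g t) {s t : ℝ} (hs : 0 < s) (hst : s ≤ t) :
    s * g t ≤ t * g s := by
  rcases hst.eq_or_lt with rfl | hst
  · rfl
  -- The origin is outside the domain, so concavity is used between `ε` and `t`, the positive value
  -- `g ε` is dropped, and `ε` tends to `0`.
  have key : ∀ ε, 0 < ε → ε < s → (s - ε) * g t ≤ (t - ε) * g s := by
    intro ε hε hεs
    have ht : 0 < t - ε := by linarith
    have h := hg.2 (mem_Ioi.2 (hs.trans hst)) (mem_Ioi.2 hε)
      (show 0 ≤ (s - ε) / (t - ε) from div_nonneg (by linarith) ht.le)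
      (show 0 ≤ (t - s) / (t - ε) from div_nonneg (by linarith) ht.le) (by field_simp; ring)
    have e : ((s - ε) / (t - ε)) • t + ((t - s) / (t - ε)) • ε = s := by
      simp only [smul_eq_mul]
      field_simp
      ring
    rw [e] at h
    simp only [smul_eq_mul] at h
    have h2 : 0 ≤ (t - s) / (t - ε) * g ε :=
      mul_nonneg (div_nonneg (by linarith) ht.le) (hpos ε hε).le
    have h3 : (s - ε) / (t - ε) * g t ≤ g s := by linarith
    rw [div_mul_eq_mul_div, div_le_iff₀ ht] at h3
    linarith
  have h1 : Tendsto (fun ε : ℝ => (s - ε) * g t) (𝓝[>] 0) (𝓝 (s * g t)) := by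
    have : ContinuousAt (fun ε : ℝ => (s - ε) * g t) 0 := by fun_prop
    simpa [ContinuousAt] using this.tendsto.mono_left nhdsWithin_le_nhds
  have h2 : Tendsto (fun ε : ℝ => (t - ε) * g s) (𝓝[>] 0) (𝓝 (t * g s)) := by
    have : ContinuousAt (fun ε : ℝ => (t - ε) * g s) 0 := by fun_prop
    simpa [ContinuousAt] using this.tendsto.mono_left nhdsWithin_le_nhds
  refine le_of_tendsto_of_tendsto h1 h2 ?_
  filter_upwards [self_mem_nhdsWithin, mem_nhdsWithin_of_mem_nhds (Iio_mem_nhds hs)] with ε h3 h4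
    using key ε h3 h4

/-- The function `v ^ 2 / g` is jointly convex. -/
lemma sq_div_le_of_le {a b v₁ v₂ G₁ G₂ G : ℝ} (ha : 0 ≤ a) (hb : 0 ≤ b) (hab : a + b = 1)
    (h1 : 0 < G₁) (h2 : 0 < G₂) (hG : a * G₁ + b * G₂ ≤ G) :
    (a * v₁ + b * v₂) ^ 2 / G ≤ a * (v₁ ^ 2 / G₁) + b * (v₂ ^ 2 / G₂) := by
  have h0 : 0 < a * G₁ + b * G₂ := by
    rcases ha.eq_or_lt with h | h
    · have : b = 1 := by linarith
      subst this
      rw [← h]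
      linarith
    · have := mul_pos h h1
      have := mul_nonneg hb h2.le
      linarith
  refine (div_le_div_of_nonneg_left (sq_nonneg _) h0 hG).trans ?_
  rw [div_le_iff₀ h0]
  have e : (a * (v₁ ^ 2 / G₁) + b * (v₂ ^ 2 / G₂)) * (a * G₁ + b * G₂) - (a * v₁ + b * v₂) ^ 2
      = a * b * (v₁ * G₂ - v₂ * G₁) ^ 2 / (G₁ * G₂) := by
    field_simp
    ring
  have : 0 ≤ a * b * (v₁ * G₂ - v₂ * G₁) ^ 2 / (G₁ * G₂) := by positivity
  linarith

/-- Taylor's inequality of order one on `[0, 1]`. -/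
lemma add_deriv_le_of_deriv2_nonneg {k k' k'' : ℝ → ℝ}
    (h1 : ∀ x ∈ Icc (0 : ℝ) 1, HasDerivAt k (k' x) x)
    (h2 : ∀ x ∈ Icc (0 : ℝ) 1, HasDerivAt k' (k'' x) x)
    (h3 : ∀ x ∈ Icc (0 : ℝ) 1, 0 ≤ k'' x) : k 0 + k' 0 ≤ k 1 := by
  obtain ⟨ξ, hξ, e1⟩ := exists_hasDerivAt_eq_slope k k' one_pos
    (fun x hx => (h1 x hx).continuousAt.continuousWithinAt)
    fun x hx => h1 x (Ioo_subset_Icc_self hx)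
  have hsub : Icc 0 ξ ⊆ Icc (0 : ℝ) 1 := Icc_subset_Icc_right hξ.2.le
  obtain ⟨η, hη, e2⟩ := exists_hasDerivAt_eq_slope k' k'' hξ.1
    (fun x hx => (h2 x (hsub hx)).continuousAt.continuousWithinAt)
    fun x hx => h2 x (hsub (Ioo_subset_Icc_self hx))
  have h4 := h3 η (hsub (Ioo_subset_Icc_self hη))
  rw [e2, sub_zero, le_div_iff₀ hξ.1] at h4
  rw [sub_zero, div_one] at e1
  linarith

namespace MemClassF

variable {f : ℝ → ℝ}

lemma hasDerivAt (hf : MemClassF f) {t : ℝ} (ht : 0 < t) : HasDerivAt f (deriv f t) t :=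
  (hf.differentiableOn.differentiableAt (Ioi_mem_nhds ht)).hasDerivAt

lemma hasDerivAt_deriv (hf : MemClassF f) {t : ℝ} (ht : 0 < t) :
    HasDerivAt (deriv f) (deriv (deriv f) t) t :=
  (hf.differentiableOn_deriv.differentiableAt (Ioi_mem_nhds ht)).hasDerivAt

lemma shift (hf : MemClassF f) (c : ℝ) :
    MemClassF (shift f c) ∧ ∀ t, 0 < t → deriv (deriv (_root_.shift f c)) t = deriv (deriv f) t := by
  have h1 : ∀ t, 0 < t → HasDerivAt (_root_.shift f c) (deriv f t - c) t := fun t ht => by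
    have h := (hf.hasDerivAt ht).sub (((hasDerivAt_id t).sub_const 1).const_mul c)
    exact h.congr_deriv (by simp)
  have h2 : ∀ t, 0 < t → deriv (_root_.shift f c) =ᶠ[𝓝 t] fun s => deriv f s - c := fun t ht => by
    filter_upwards [Ioi_mem_nhds ht] with s hs using (h1 s hs).deriv
  have h3 : ∀ t, 0 < t → HasDerivAt (deriv (_root_.shift f c)) (deriv (deriv f) t) t :=
    fun t ht => ((hf.hasDerivAt_deriv ht).sub_const c).congr_of_eventuallyEq (h2 t ht)
  have h4 : ∀ t, 0 < t → deriv (deriv (_root_.shift f c)) t = deriv (deriv f) t :=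
    fun t ht => (h3 t ht).deriv
  refine ⟨⟨hf.toIsGenerator.shift c, fun t ht => (h1 t ht).differentiableAt.differentiableWithinAt,
    fun t ht => (h3 t ht).differentiableAt.differentiableWithinAt, fun t ht => ?_, ?_⟩, h4⟩
  · rw [h4 t ht]
    exact hf.deriv2_pos t ht
  · refine hf.concaveOn_inv.congr fun t ht => ?_
    simp only [h4 t ht]

lemma inv_pos (hf : MemClassF f) (t : ℝ) (ht : 0 < t) : 0 < 1 / deriv (deriv f) t :=
  one_div_pos.2 (hf.deriv2_pos t ht)

lemma antitoneOn_deriv2 (hf : MemClassF f) : AntitoneOn (deriv (deriv f)) (Ioi 0) := by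
  intro s hs t ht hst
  have := hf.concaveOn_inv.monotoneOn_of_pos hf.inv_pos hs ht hst
  exact (one_div_le_one_div (hf.deriv2_pos s hs) (hf.deriv2_pos t ht)).1 this

lemma monotoneOn_mul_deriv2 (hf : MemClassF f) :
    MonotoneOn (fun t => t * deriv (deriv f) t) (Ioi 0) := by
  intro s hs t ht hst
  have h := hf.concaveOn_inv.mul_le_mul_of_pos hf.inv_pos hs hst
  have h1 := hf.deriv2_pos s hs
  have h2 := hf.deriv2_pos t ht
  rw [mul_one_div, mul_one_div, div_le_div_iff₀ h2 h1] at h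
  exact h

lemma exists_tendsto (hf : MemClassF f) :
    ∃ L : EReal, Tendsto (fun t : ℝ => ((t * deriv (deriv f) t : ℝ) : EReal)) atTop (𝓝 L) ∧
      0 < L ∧ ∀ t : ℝ, 0 < t → ((t * deriv (deriv f) t : ℝ) : EReal) ≤ L := by
  -- Replacing `t` by `max 1 t` makes the function monotone on the whole line without changing its
  -- limit at infinity.
  set u : ℝ → EReal := fun t => ((max 1 t * deriv (deriv f) (max 1 t) : ℝ) : EReal)
  have hmono : Monotone u := fun s t hst => EReal.coe_le_coe_iff.2 <|
    hf.monotoneOn_mul_deriv2 (mem_Ioi.2 (lt_max_of_lt_left one_pos))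
      (mem_Ioi.2 (lt_max_of_lt_left one_pos))
      (max_le_max_left 1 hst)
  have hle : ∀ t : ℝ, 0 < t → ((t * deriv (deriv f) t : ℝ) : EReal) ≤ ⨆ t, u t :=
    fun t ht => le_trans (EReal.coe_le_coe_iff.2 (hf.monotoneOn_mul_deriv2 ht
      (mem_Ioi.2 (lt_max_of_lt_left one_pos)) (le_max_right 1 t))) (le_iSup u t)
  refine ⟨⨆ t, u t, ?_, ?_, hle⟩
  · refine (tendsto_atTop_iSup hmono).congr' ?_
    filter_upwards [eventually_ge_atTop 1] with t ht
    simp only [u, max_eq_right ht]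
  · refine lt_of_lt_of_le ?_ (hle 1 one_pos)
    rw [EReal.coe_pos, one_mul]
    exact hf.deriv2_pos 1 (mem_Ioi.2 one_pos)

lemma isMinorant_tangent (hf : MemClassF f) {t : ℝ} (ht : 0 < t) :
    IsMinorant f (deriv f t) (f t - t * deriv f t) := by
  obtain ⟨c, hc⟩ := hf.convexOn.exists_isMinorant ht
  have hmin : IsLocalMin (fun s => f s - c * s) t := by
    filter_upwards [Ioi_mem_nhds ht] with s hs
    have := hc s hs
    linarith
  have hd : HasDerivAt (fun s => f s - c * s) (deriv f t - c) t := by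
    exact ((hf.hasDerivAt ht).sub ((hasDerivAt_id t).const_mul c)).congr_deriv (by simp)
  have : deriv f t = c := by linarith [hmin.hasDerivAt_eq_zero hd]
  rw [this, mul_comm]
  exact hc

/-- For `t ≥ 1` one has `t f''(t) ≥ f''(1) > 0`, so `f'` grows at least logarithmically. Hence, for
a nonnegative `f` of the class, a finite divergence forces absolute continuity
(`ac_of_eDiv_ne_top`). -/
lemma slopeAtTop_eq_top (hf : MemClassF f) : slopeAtTop f = ⊤ := by
  set c := deriv (deriv f) 1
  have hc : 0 < c := hf.deriv2_pos 1 (mem_Ioi.2 one_pos)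
  have hmono : MonotoneOn (fun t => deriv f t - c * Real.log t) (Ici 1) := by
    have hd : ∀ t ∈ Ici (1 : ℝ), HasDerivAt (fun t => deriv f t - c * Real.log t)
        (deriv (deriv f) t - c * t⁻¹) t := fun t ht =>
      have ht0 : 0 < t := lt_of_lt_of_le one_pos ht
      (hf.hasDerivAt_deriv ht0).sub ((Real.hasDerivAt_log ht0.ne').const_mul c)
    refine monotoneOn_of_deriv_nonneg (convex_Ici 1)
      (fun t ht => (hd t ht).continuousAt.continuousWithinAt)
      (fun t ht => (hd t (interior_subset ht)).differentiableAt.differentiableWithinAt)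
      fun t ht => ?_
    have ht1 : 1 ≤ t := interior_subset ht
    have ht0 : 0 < t := by linarith
    rw [(hd t ht1).deriv, sub_nonneg, ← div_eq_mul_inv, div_le_iff₀ ht0, mul_comm]
    simpa [c] using hf.monotoneOn_mul_deriv2 (mem_Ioi.2 one_pos) ht0 ht1
  refine EReal.eq_top_iff_forall_lt _ |>.2 fun y => ?_
  have h1 : Tendsto (fun t => deriv f 1 + c * Real.log t) atTop atTop :=
    tendsto_atTop_add_const_left _ _ (Real.tendsto_log_atTop.const_mul_atTop hc)
  obtain ⟨t, hty, ht⟩ := ((h1.eventually_gt_atTop y).and (eventually_ge_atTop 1)).exists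
  have h2 := hmono self_mem_Ici ht ht
  simp only [Real.log_one, mul_zero, sub_zero] at h2
  have ht0 : 0 < t := lt_of_lt_of_le one_pos ht
  refine lt_of_lt_of_le (EReal.coe_lt_coe_iff.2 ?_)
    (IsNonnegGenerator.coe_le_slopeAtTop (hf.isMinorant_tangent ht0))
  linarith

/-- Joint convexity of the Bregman divergence. -/
lemma bregman_convex (hf : MemClassF f) {a b s₁ s₂ t₁ t₂ : ℝ} (ha : 0 ≤ a) (hb : 0 ≤ b)
    (hab : a + b = 1) (hs₁ : 0 < s₁) (hs₂ : 0 < s₂) (ht₁ : 0 < t₁) (ht₂ : 0 < t₂) :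
    f (a * s₁ + b * s₂) - f (a * t₁ + b * t₂)
        - deriv f (a * t₁ + b * t₂) * ((a * s₁ + b * s₂) - (a * t₁ + b * t₂))
      ≤ a * (f s₁ - f t₁ - deriv f t₁ * (s₁ - t₁))
        + b * (f s₂ - f t₂ - deriv f t₂ * (s₂ - t₂)) := by
  have hpos : ∀ x y : ℝ, 0 < x → 0 < y → 0 < a * x + b * y := fun x y hx hy =>
    (convex_Ioi (0 : ℝ)) (mem_Ioi.2 hx) (mem_Ioi.2 hy) ha hb hab
  have seg : ∀ s t : ℝ, 0 < s → 0 < t → ∀ l ∈ Icc (0 : ℝ) 1, 0 < t + l * (s - t) := by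
    intro s t hs ht l hl
    have : 0 < (1 - l) * t + l * s :=
      (convex_Ioi (0 : ℝ)) (mem_Ioi.2 ht) (mem_Ioi.2 hs) (by linarith [hl.2]) hl.1 (by ring)
    linarith
  have hl : ∀ s t l : ℝ, HasDerivAt (fun l => t + l * (s - t)) (s - t) l := fun s t l => by
    simpa using ((hasDerivAt_id l).mul_const (s - t)).const_add t
  have d1 : ∀ s t : ℝ, 0 < s → 0 < t → ∀ l ∈ Icc (0 : ℝ) 1,
      HasDerivAt (fun l => f (t + l * (s - t))) (deriv f (t + l * (s - t)) * (s - t)) l :=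
    fun s t hs ht l hl' => (hf.hasDerivAt (seg s t hs ht l hl')).comp l (hl s t l)
  have d2 : ∀ s t : ℝ, 0 < s → 0 < t → ∀ l ∈ Icc (0 : ℝ) 1,
      HasDerivAt (fun l => deriv f (t + l * (s - t)) * (s - t))
        (deriv (deriv f) (t + l * (s - t)) * (s - t) * (s - t)) l :=
    fun s t hs ht l hl' =>
      ((hf.hasDerivAt_deriv (seg s t hs ht l hl')).comp l (hl s t l)).mul_const _
  set s := a * s₁ + b * s₂
  set t := a * t₁ + b * t₂
  have hs := hpos s₁ s₂ hs₁ hs₂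
  have ht := hpos t₁ t₂ ht₁ ht₂
  -- A Bregman divergence is the Taylor remainder of `f` along the segment from `t` to `s`, so the
  -- claim is `k 0 + k' 0 ≤ k 1` for the convexity gap `k` of `f` along the three segments.
  have h := add_deriv_le_of_deriv2_nonneg
    (k := fun l => a * f (t₁ + l * (s₁ - t₁)) + b * f (t₂ + l * (s₂ - t₂)) - f (t + l * (s - t)))
    (fun l hl' => (((d1 s₁ t₁ hs₁ ht₁ l hl').const_mul a).add
      ((d1 s₂ t₂ hs₂ ht₂ l hl').const_mul b)).sub (d1 s t hs ht l hl'))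
    (fun l hl' => (((d2 s₁ t₁ hs₁ ht₁ l hl').const_mul a).add
      ((d2 s₂ t₂ hs₂ ht₂ l hl').const_mul b)).sub (d2 s t hs ht l hl'))
    fun l hl' => by
      have p1 := seg s₁ t₁ hs₁ ht₁ l hl'
      have p2 := seg s₂ t₂ hs₂ ht₂ l hl'
      have e : t + l * (s - t) = a * (t₁ + l * (s₁ - t₁)) + b * (t₂ + l * (s₂ - t₂)) := by
        simp only [s, t]
        ring
      have e' : s - t = a * (s₁ - t₁) + b * (s₂ - t₂) := by
        simp only [s, t]
        ring
      -- This is where concavity of `1 / f''` enters: `v ^ 2 f''(x)` is `v ^ 2 / g` evaluated at the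
      -- concave function `g = 1 / f''`.
      have hq := sq_div_le_of_le (v₁ := s₁ - t₁) (v₂ := s₂ - t₂) ha hb hab (hf.inv_pos _ p1)
        (hf.inv_pos _ p2) (hf.concaveOn_inv.2 (mem_Ioi.2 p1) (mem_Ioi.2 p2) ha hb hab)
      simp only [smul_eq_mul, ← e, ← e', div_div_eq_mul_div, div_one] at hq
      nlinarith [hq]
  simp only [zero_mul, add_zero, one_mul, add_sub_cancel] at h
  linarith

/-- The supporting hyperplane of the Bregman divergence `B(s, t)` at `(S, c)`, as an affine minorant
of `f` in the variable `s`. -/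
lemma isMinorant_bregman (hf : MemClassF f) {t S c : ℝ} (ht : 0 < t) (hS : 0 < S) (hc : 0 < c) :
    IsMinorant f (deriv f t + deriv f S - deriv f c)
      ((f t - t * deriv f t) + (f S - S * deriv f S) - (f c - c * deriv f c)
        - deriv (deriv f) c * (S - c) * (t - c)) := by
  intro s hs
  -- `φ` is the Bregman divergence along the segment from `(S, c)` to `(s, t)`. Being convex, it
  -- satisfies `φ' 0 ≤ φ 1 - φ 0`, which rearranges to the claim.
  set φ : ℝ → ℝ := fun τ => f (S + τ * (s - S)) - f (c + τ * (t - c))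
    - deriv f (c + τ * (t - c)) * ((S + τ * (s - S)) - (c + τ * (t - c)))
  have hl : ∀ x y l : ℝ, HasDerivAt (fun l => x + l * (y - x)) (y - x) l := fun x y l => by
    simpa using ((hasDerivAt_id l).mul_const (y - x)).const_add x
  have hS' : 0 < S + 0 * (s - S) := by simpa
  have hc' : 0 < c + 0 * (t - c) := by simpa
  have hφ : HasDerivAt φ (deriv f S * (s - S) - deriv f c * (t - c)
      - (deriv (deriv f) c * (t - c) * (S - c) + deriv f c * ((s - S) - (t - c)))) 0 := by
    have h := (((hf.hasDerivAt hS').comp 0 (hl S s 0)).sub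
      ((hf.hasDerivAt hc').comp 0 (hl c t 0))).sub
      (((hf.hasDerivAt_deriv hc').comp 0 (hl c t 0)).mul ((hl S s 0).sub (hl c t 0)))
    exact h.congr_deriv (by simp)
  have hle : ∀ τ, 0 < τ → τ < 1 → φ τ - φ 0 ≤ τ * (φ 1 - φ 0) := by
    intro τ h0 h1
    have h := hf.bregman_convex (show 0 ≤ 1 - τ by linarith) h0.le (by ring) hS hs hc ht
    have e1 : (1 - τ) * S + τ * s = S + τ * (s - S) := by ring
    have e2 : (1 - τ) * c + τ * t = c + τ * (t - c) := by ring
    rw [e1, e2] at h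
    simp only [φ, zero_mul, add_zero, one_mul, add_sub_cancel]
    linarith
  have hlim := hφ.tendsto_slope_zero_right
  have hfin : deriv f S * (s - S) - deriv f c * (t - c)
      - (deriv (deriv f) c * (t - c) * (S - c) + deriv f c * ((s - S) - (t - c)))
      ≤ φ 1 - φ 0 := by
    refine le_of_tendsto hlim ?_
    filter_upwards [self_mem_nhdsWithin, mem_nhdsWithin_of_mem_nhds (Iio_mem_nhds one_pos)]
      with τ h0 h1
    simp only [mem_Ioi, mem_Iio] at h0 h1
    rw [zero_add, smul_eq_mul, inv_mul_eq_div, div_le_iff₀ h0, mul_comm]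
    exact hle τ h0 h1
  simp only [φ, zero_mul, add_zero, one_mul, add_sub_cancel] at hfin
  linarith

end MemClassF

/-! ### Divergences as suprema of tangent functionals. -/

section

variable {α β : Type*} [MeasurableSpace α] [MeasurableSpace β]

/-- Affine minorants, chosen measurably, give lower bounds for the divergence. -/
lemma integral_minorant_le_eDiv {f : ℝ → ℝ} {P Q : Measure α} [IsFiniteMeasure P]
    [IsFiniteMeasure Q] (hD : eDiv f P Q ≠ ∞) {a b : α → ℝ} (hab : ∀ x, IsMinorant f (a x) (b x))
    (ha : Integrable a P) (hb : Integrable b Q) :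
    ∫ x, a x ∂P + ∫ x, b x ∂Q ≤ (eDiv f P Q).toReal := by
  set μ := P + Q
  have hP : P ≪ μ := (Measure.le_add_right le_rfl).absolutelyContinuous
  have hQ : Q ≪ μ := (Measure.le_add_left le_rfl).absolutelyContinuous
  have hΦ : Measurable fun x => persp f (P.rnDeriv μ x) (Q.rnDeriv μ x) :=
    (Measure.measurable_rnDeriv _ _).persp f (Measure.measurable_rnDeriv _ _)
  have ha' := (integrable_rnDeriv_smul_iff hP).2 ha
  have hb' := (integrable_rnDeriv_smul_iff hQ).2 hb
  have hfin : ∀ᵐ x ∂μ, persp f (P.rnDeriv μ x) (Q.rnDeriv μ x) < ∞ := ae_lt_top hΦ hD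
  rw [← integral_rnDeriv_smul hP, ← integral_rnDeriv_smul hQ, ← integral_add ha' hb', eDiv,
    ← integral_toReal hΦ.aemeasurable hfin]
  refine integral_mono_ae (ha'.add hb') (integrable_toReal_of_lintegral_ne_top hΦ.aemeasurable hD) ?_
  filter_upwards [hfin, Measure.rnDeriv_lt_top P μ, Measure.rnDeriv_lt_top Q μ] with x h1 h2 h3
  have h := ofReal_le_persp (hab x) h2.ne h3.ne
  rw [ENNReal.ofReal_le_iff_le_toReal h1.ne] at h
  simp only [smul_eq_mul]
  linarith

lemma ac_of_eDiv_ne_top {f : ℝ → ℝ} (hf : IsNonnegGenerator f) (hs : slopeAtTop f = ⊤)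
    {P Q : Measure α} [IsFiniteMeasure P] [IsFiniteMeasure Q] (hD : eDiv f P Q ≠ ∞) : P ≪ Q := by
  rw [← Measure.singularPart_eq_zero]
  rw [eDiv_eq_rnDeriv, hf.persp_zero_right (by simp), hs] at hD
  by_contra h
  refine hD ?_
  rw [EReal.toENNReal_top, mul_one, ENNReal.top_mul, add_top]
  simpa using h

end

/-- The clamping of a real number to `[1 / (k + 2), k + 2]`. -/
noncomputable def clamp (k : ℕ) (r : ℝ) : ℝ := max (1 / ((k : ℝ) + 2)) (min ((k : ℝ) + 2) r)

lemma one_div_add_two_lt_one (k : ℕ) : 1 / ((k : ℝ) + 2) < 1 := by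
  have h : (0 : ℝ) ≤ k := Nat.cast_nonneg k
  rw [div_lt_one (by linarith)]
  linarith

lemma clamp_mem (k : ℕ) (r : ℝ) : clamp k r ∈ Icc (1 / ((k : ℝ) + 2)) ((k : ℝ) + 2) := by
  have h : (0 : ℝ) ≤ k := Nat.cast_nonneg k
  refine ⟨le_max_left _ _, max_le ?_ (min_le_left _ _)⟩
  linarith [one_div_add_two_lt_one k]

lemma clamp_pos (k : ℕ) (r : ℝ) : 0 < clamp k r :=
  lt_of_lt_of_le (by positivity) (clamp_mem k r).1

/-- The clamping interval contains `1` in its interior, so a point that gets moved is moved towards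
`1` without reaching it; likewise in `clamp_lt_one_of_lt`. -/
lemma one_lt_clamp_of_lt {k : ℕ} {r : ℝ} (h : clamp k r < r) : 1 < clamp k r := by
  have hk : (0 : ℝ) ≤ k := Nat.cast_nonneg k
  have h1 : (k : ℝ) + 2 < r := by
    by_contra! hle
    rw [clamp, min_eq_right hle] at h
    exact absurd (le_max_right _ _) (not_le.2 h)
  rw [clamp, min_eq_left h1.le]
  exact lt_max_of_lt_right (by linarith)

lemma clamp_lt_one_of_lt {k : ℕ} {r : ℝ} (h : r < clamp k r) : clamp k r < 1 := by
  rcases lt_max_iff.1 h with h1 | h1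
  · have h2 := one_div_add_two_lt_one k
    exact max_lt h2 (min_lt_of_right_lt (h1.trans h2))
  · exact absurd h1 (not_lt.2 (min_le_right _ _))

lemma measurable_clamp (k : ℕ) : Measurable (clamp k) := by
  unfold clamp
  fun_prop

lemma tendsto_clamp {r : ℝ} (hr : 0 ≤ r) : Tendsto (fun k => clamp k r) atTop (𝓝 r) := by
  have h0 : Tendsto (fun k : ℕ => (k : ℝ) + 2) atTop atTop :=
    tendsto_atTop_add_const_right _ _ tendsto_natCast_atTop_atTop
  have h1 : Tendsto (fun k : ℕ => 1 / ((k : ℝ) + 2)) atTop (𝓝 0) :=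
    tendsto_const_nhds.div_atTop h0
  have h2 : Tendsto (fun k : ℕ => min ((k : ℝ) + 2) r) atTop (𝓝 r) := by
    refine tendsto_const_nhds.congr' ?_
    filter_upwards [h0.eventually_ge_atTop r] with k hk
    rw [min_eq_right hk]
  have h3 := h1.max h2
  rwa [max_eq_right hr] at h3

namespace MemClassF

variable {f : ℝ → ℝ}

lemma exists_bound (hf : MemClassF f) {a b : ℝ} (ha : 0 < a) :
    ∃ C, ∀ t ∈ Icc a b, |f t| ≤ C ∧ |deriv f t| ≤ C ∧ |deriv (deriv f) t| ≤ C ∧ |t| ≤ C := by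
  have hsub : Icc a b ⊆ Ioi 0 := fun t ht => lt_of_lt_of_le ha ht.1
  obtain ⟨C1, h1⟩ := isCompact_Icc.exists_bound_of_continuousOn
    (hf.differentiableOn.continuousOn.mono hsub)
  obtain ⟨C2, h2⟩ := isCompact_Icc.exists_bound_of_continuousOn
    (hf.differentiableOn_deriv.continuousOn.mono hsub)
  refine ⟨max (max C1 C2) (max (deriv (deriv f) a) b), fun t ht => ⟨?_, ?_, ?_, ?_⟩⟩
  · exact (h1 t ht).trans ((le_max_left _ _).trans (le_max_left _ _))
  · exact (h2 t ht).trans ((le_max_right _ _).trans (le_max_left _ _))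
  · rw [abs_of_pos (hf.deriv2_pos t (hsub ht))]
    exact (hf.antitoneOn_deriv2 ha (hsub ht) ht.1).trans
      ((le_max_left _ _).trans (le_max_right _ _))
  · rw [abs_of_pos (hsub ht)]
    exact ht.2.trans ((le_max_right _ _).trans (le_max_right _ _))

variable {α : Type*} [MeasurableSpace α]

lemma measurable_comp (hf : MemClassF f) {T : α → ℝ} (hT : Measurable T) (hT0 : ∀ x, 0 < T x) :
    Measurable fun x => f (T x) := by
  have h : (fun x => f (T x)) = fun x => (Ioi 0).indicator f (T x) := by
    ext x
    simp [hT0 x]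
  rw [h]
  exact hf.toIsGenerator.measurable_indicator.comp hT

variable {T : α → ℝ} {a b : ℝ}

lemma integrable_deriv_comp (hf : MemClassF f) (P : Measure α) [IsFiniteMeasure P]
    (hT : Measurable T) (ha : 0 < a) (hTab : ∀ x, T x ∈ Icc a b) :
    Integrable (fun x => deriv f (T x)) P := by
  obtain ⟨C, hC⟩ := hf.exists_bound (b := b) ha
  exact Integrable.of_bound ((measurable_deriv f).comp hT).aestronglyMeasurable C
    (ae_of_all _ fun x => (hC _ (hTab x)).2.1)

lemma integrable_intercept_comp (hf : MemClassF f) (P : Measure α) [IsFiniteMeasure P]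
    (hT : Measurable T) (ha : 0 < a) (hTab : ∀ x, T x ∈ Icc a b) :
    Integrable (fun x => f (T x) - T x * deriv f (T x)) P := by
  obtain ⟨C, hC⟩ := hf.exists_bound (b := b) ha
  have hT0 : ∀ x, 0 < T x := fun x => ha.trans_le (hTab x).1
  refine (Integrable.of_bound (hf.measurable_comp hT hT0).aestronglyMeasurable C
    (ae_of_all _ fun x => (hC _ (hTab x)).1)).sub ?_
  refine (hf.integrable_deriv_comp P hT ha hTab).bdd_mul (c := C) hT.aestronglyMeasurable
    (ae_of_all _ fun x => (hC _ (hTab x)).2.2.2)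

end MemClassF

/-- The linear functional of `(P, Q)` given by the tangents of `f` at the points `T x`. -/
noncomputable def tangentFunctional {α : Type*} [MeasurableSpace α] (f : ℝ → ℝ) (P Q : Measure α)
    (T : α → ℝ) : ℝ :=
  ∫ x, deriv f (T x) ∂P + ∫ x, (f (T x) - T x * deriv f (T x)) ∂Q

section

variable {α β : Type*} [MeasurableSpace α] [MeasurableSpace β] {f : ℝ → ℝ}

lemma tangentFunctional_le (hf : MemClassF f) {P Q : Measure α} [IsFiniteMeasure P]
    [IsFiniteMeasure Q] (hD : eDiv f P Q ≠ ∞) {T : α → ℝ} {a b : ℝ} (hT : Measurable T)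
    (ha : 0 < a) (hTab : ∀ x, T x ∈ Icc a b) :
    tangentFunctional f P Q T ≤ (eDiv f P Q).toReal :=
  integral_minorant_le_eDiv hD (fun x => hf.isMinorant_tangent (ha.trans_le (hTab x).1))
    (hf.integrable_deriv_comp P hT ha hTab) (hf.integrable_intercept_comp Q hT ha hTab)

lemma tangentFunctional_map (hf : MemClassF f) (P Q : Measure α) {g : α → β} (hg : Measurable g)
    {T : β → ℝ} (hT : Measurable T) (hT0 : ∀ x, 0 < T x) :
    tangentFunctional f (P.map g) (Q.map g) T = tangentFunctional f P Q (fun x => T (g x)) := by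
  unfold tangentFunctional
  have h1 : Measurable fun x => deriv f (T x) := (measurable_deriv f).comp hT
  rw [integral_map hg.aemeasurable h1.aestronglyMeasurable, integral_map hg.aemeasurable]
  exact ((hf.measurable_comp hT hT0).sub (hT.mul h1)).aestronglyMeasurable

lemma tangentFunctional_one (f : ℝ → ℝ) (hf : f 1 = 0) (P Q : Measure α)
    [IsProbabilityMeasure P] [IsProbabilityMeasure Q] :
    tangentFunctional f P Q (fun _ => 1) = 0 := by
  simp [tangentFunctional, hf]

/-- The divergence is the supremum of the tangent functionals. -/
lemma toReal_eDiv_le (hf : MemClassF f) (hn : IsNonnegGenerator f)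
    {P Q : Measure α} [IsProbabilityMeasure P] [IsProbabilityMeasure Q] (hac : P ≪ Q) {C : ℝ}
    (h : ∀ (T : α → ℝ) (a b : ℝ), Measurable T → 0 < a → (∀ x, T x ∈ Icc a b) →
      tangentFunctional f P Q T ≤ C) :
    (eDiv f P Q).toReal ≤ C := by
  have hC : 0 ≤ C := by
    rw [← tangentFunctional_one f hf.map_one P Q]
    exact h _ 1 1 measurable_const one_pos fun _ => by simp
  refine ENNReal.toReal_le_of_le_ofReal hC ?_
  set r := P.rnDeriv Q
  have hr : Measurable r := Measure.measurable_rnDeriv _ _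
  set T : ℕ → α → ℝ := fun k x => clamp k (r x).toReal
  have hT : ∀ k, Measurable (T k) := fun k => (measurable_clamp k).comp hr.ennreal_toReal
  set φ : ℕ → α → ℝ := fun k x =>
    (r x).toReal * deriv f (T k x) + (f (T k x) - T k x * deriv f (T k x))
  have hφm : ∀ k, Measurable (φ k) := fun k =>
    (hr.ennreal_toReal.mul ((measurable_deriv f).comp (hT k))).add
      ((hf.measurable_comp (hT k) fun x => clamp_pos _ _).sub
        ((hT k).mul ((measurable_deriv f).comp (hT k))))
  -- `φ k x` is the tangent at the clamped density, evaluated at the density itself. As `f` has its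
  -- minimum at `1` and clamping moves towards `1`, the tangent does not decrease from the clamped
  -- point to the true one. Thus `φ k` is nonnegative and Fatou's lemma applies.
  have hsign : ∀ k x, f (T k x) ≤ φ k x := by
    intro k x
    have h0 : 0 < T k x := clamp_pos _ _
    have ht := hf.isMinorant_tangent h0 1 one_pos
    have hnn := hn.nonneg _ h0
    rw [hf.map_one] at ht
    suffices 0 ≤ deriv f (T k x) * ((r x).toReal - T k x) by
      simp only [φ]
      linarith
    rcases lt_trichotomy (T k x) (r x).toReal with hlt | heq | hgt
    · have h1 : 1 < T k x := one_lt_clamp_of_lt hlt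
      have h2 : 0 ≤ deriv f (T k x) := by
        by_contra! hneg
        nlinarith
      exact mul_nonneg h2 (by linarith)
    · rw [heq]
      simp
    · have h1 : T k x < 1 := clamp_lt_one_of_lt hgt
      have h2 : deriv f (T k x) ≤ 0 := by
        by_contra! hpos
        nlinarith
      exact mul_nonneg_of_nonpos_of_nonpos h2 (by linarith)
  -- Testing against each affine minorant treats points of zero density too, where the left side is
  -- `f(0+)` and may be infinite.
  have hpt : ∀ᵐ x ∂Q, persp f (r x) 1 ≤ liminf (fun k => ENNReal.ofReal (φ k x)) atTop := by
    filter_upwards [Measure.rnDeriv_lt_top P Q] with x hx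
    refine persp_le hx.ne (by simp) fun a b hab => ?_
    have h1 : Tendsto (fun k => ENNReal.ofReal (a * T k x + b)) atTop
        (𝓝 (ENNReal.ofReal (a * (r x).toReal + b))) :=
      ENNReal.tendsto_ofReal (((tendsto_clamp ENNReal.toReal_nonneg).const_mul a).add_const b)
    rw [ENNReal.toReal_one, mul_one, ← h1.liminf_eq]
    refine liminf_le_liminf (Eventually.of_forall fun k => ENNReal.ofReal_le_ofReal ?_)
    exact (hab _ (clamp_pos _ _)).trans (hsign k x)
  have hint : ∀ k, ∫⁻ x, ENNReal.ofReal (φ k x) ∂Q ≤ ENNReal.ofReal C := by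
    intro k
    have hk : 0 < 1 / ((k : ℝ) + 2) := by positivity
    have i1 := hf.integrable_deriv_comp P (hT k) hk fun x => clamp_mem _ _
    have i2 := hf.integrable_intercept_comp Q (hT k) hk fun x => clamp_mem _ _
    have i3 : Integrable (fun x => (r x).toReal * deriv f (T k x)) Q :=
      (integrable_rnDeriv_smul_iff hac).2 i1
    have i4 : Integrable (φ k) Q := i3.add i2
    rw [← ofReal_integral_eq_lintegral_ofReal i4
      (ae_of_all _ fun x => (hn.nonneg _ (clamp_pos _ _)).trans (hsign k x))]
    refine ENNReal.ofReal_le_ofReal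
      (le_trans (le_of_eq ?_) (h (T k) _ _ (hT k) hk fun x => clamp_mem _ _))
    rw [tangentFunctional, ← integral_rnDeriv_smul hac]
    exact integral_add i3 i2
  rw [eDiv_eq_rnDeriv, (Measure.singularPart_eq_zero P Q).2 hac]
  simp only [Measure.coe_zero, Pi.zero_apply, mul_zero, add_zero]
  calc ∫⁻ x, persp f (r x) 1 ∂Q
      ≤ ∫⁻ x, liminf (fun k => ENNReal.ofReal (φ k x)) atTop ∂Q := lintegral_mono_ae hpt
    _ ≤ liminf (fun k => ∫⁻ x, ENNReal.ofReal (φ k x) ∂Q) atTop :=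
      lintegral_liminf_le fun k => (hφm k).ennreal_ofReal
    _ ≤ ENNReal.ofReal C := liminf_le_of_le (by isBoundedDefault) fun b hb => by
      obtain ⟨k, hk⟩ := hb.exists
      exact hk.trans (hint k)

/-- The tangent functionals satisfy the inequality of `eDiv_add_eDiv_snd_le`. -/
lemma tangentFunctional_add_le {γ : Type*} [MeasurableSpace γ] (hf : MemClassF f)
    (ρ : Measure (α × β)) [IsProbabilityMeasure ρ] (P : Measure α)
    [IsProbabilityMeasure P] (M : Measure β) [IsProbabilityMeasure M] {g : β → γ}
    (hg : Measurable g) (hD : eDiv f ρ (P.prod M) ≠ ∞)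
    (hE : eDiv f (ρ.snd.map g) (M.map g) ≠ ∞) {T : α × γ → ℝ} {S : β → ℝ} {a b : ℝ} (ha : 0 < a)
    (hT : Measurable T) (hTab : ∀ x, T x ∈ Icc a b) (hS : Measurable S)
    (hSab : ∀ x, S x ∈ Icc a b) :
    tangentFunctional f (ρ.map (Prod.map id g)) (P.prod (M.map g)) T
        + tangentFunctional f ρ.snd M S
      ≤ (eDiv f ρ (P.prod M)).toReal + (eDiv f (ρ.snd.map g) (M.map g)).toReal := by
  set ν := P.prod M
  have hTi : ∀ y, Integrable (fun x => T (x, y)) P := fun y =>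
    Integrable.of_mem_Icc a b (hT.comp measurable_prodMk_right).aemeasurable
      (ae_of_all _ fun x => hTab _)
  -- If `T` is the density of the law of `(A, g(B))`, this average is the density of the law of
  -- `g(B)`, the right base point for the Bregman divergence.
  set c : γ → ℝ := fun y => ∫ x, T (x, y) ∂P
  have hc : Measurable c := (hT.stronglyMeasurable.integral_prod_left' (μ := P)).measurable
  have hcab : ∀ y, c y ∈ Icc a b := by
    intro y
    have h1 := integral_mono (integrable_const a) (hTi y) fun x => (hTab (x, y)).1
    have h2 := integral_mono (hTi y) (integrable_const b) fun x => (hTab (x, y)).2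
    simp only [integral_const, probReal_univ, one_smul] at h1 h2
    exact ⟨h1, h2⟩
  set t : α × β → ℝ := fun z => T (z.1, g z.2)
  set s : α × β → ℝ := fun z => S z.2
  set d : α × β → ℝ := fun z => c (g z.2)
  have ht : Measurable t := by fun_prop
  have hs : Measurable s := by fun_prop
  have hd : Measurable d := by fun_prop
  have htab : ∀ z, t z ∈ Icc a b := fun z => hTab _
  have hsab : ∀ z, s z ∈ Icc a b := fun z => hSab _
  have hdab : ∀ z, d z ∈ Icc a b := fun z => hcab _
  have e1 : tangentFunctional f (ρ.map (Prod.map id g)) (P.prod (M.map g)) T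
      = tangentFunctional f ρ ν t := by
    have : P.prod (M.map g) = ν.map (Prod.map id g) := by
      rw [← Measure.map_prod_map _ _ measurable_id hg, Measure.map_id]
    rw [this, tangentFunctional_map hf _ _ (measurable_id.prodMap hg) hT
      fun x => ha.trans_le (hTab x).1]
    rfl
  have hsnd : M = ν.map Prod.snd := (Measure.snd_prod (μ := P) (ν := M)).symm
  have e2 : tangentFunctional f ρ.snd M S = tangentFunctional f ρ ν s := by
    conv_lhs => rw [hsnd]
    exact tangentFunctional_map hf _ _ measurable_snd hS fun x => ha.trans_le (hSab x).1
  have e3 : tangentFunctional f (ρ.snd.map g) (M.map g) c = tangentFunctional f ρ ν d := by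
    rw [tangentFunctional_map hf _ _ hg hc fun x => ha.trans_le (hcab x).1]
    conv_lhs => rw [hsnd]
    exact tangentFunctional_map hf _ _ measurable_snd (hc.comp hg)
      fun x => ha.trans_le (hcab _).1
  have hle := tangentFunctional_le hf hE hc ha hcab
  obtain ⟨C, hC⟩ := hf.exists_bound (b := b) ha
  have it : Integrable t ν := Integrable.of_mem_Icc a b ht.aemeasurable (ae_of_all _ htab)
  have is : Integrable s ν := Integrable.of_mem_Icc a b hs.aemeasurable (ae_of_all _ hsab)
  have id' : Integrable d ν := Integrable.of_mem_Icc a b hd.aemeasurable (ae_of_all _ hdab)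
  set q : α × β → ℝ := fun z => deriv (deriv f) (d z) * (s z - d z)
  have hq : Measurable q := ((measurable_deriv _).comp hd).mul (hs.sub hd)
  have hqC : ∀ z, ‖q z‖ ≤ C * (C + C) := by
    intro z
    rw [Real.norm_eq_abs, abs_mul]
    refine mul_le_mul (hC _ (hdab z)).2.2.1 ?_ (abs_nonneg _)
      ((abs_nonneg _).trans (hC _ (hdab z)).1)
    exact (abs_sub _ _).trans (add_le_add (hC _ (hsab z)).2.2.2 (hC _ (hdab z)).2.2.2)
  have icross : Integrable (fun z => q z * (t z - d z)) ν :=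
    (it.sub id').bdd_mul (c := C * (C + C)) hq.aestronglyMeasurable (ae_of_all _ hqC)
  -- The factor `q` depends only on the second coordinate, and for fixed second coordinate `t - d`
  -- has mean zero under `P` by the choice of `c`. So the mixed term of `isMinorant_bregman`
  -- disappears.
  have hcross : ∫ z, q z * (t z - d z) ∂ν = 0 := by
    rw [integral_prod_symm _ icross]
    refine integral_eq_zero_of_ae (ae_of_all _ fun y => ?_)
    simp only [Pi.zero_apply, q, t, s, d]
    rw [integral_const_mul, integral_sub (hTi (g y)) (integrable_const _)]
    simp [c]
  have i1t := hf.integrable_deriv_comp ρ ht ha htab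
  have i1s := hf.integrable_deriv_comp ρ hs ha hsab
  have i1d := hf.integrable_deriv_comp ρ hd ha hdab
  have i2t := hf.integrable_intercept_comp ν ht ha htab
  have i2s := hf.integrable_intercept_comp ν hs ha hsab
  have i2d := hf.integrable_intercept_comp ν hd ha hdab
  have key := integral_minorant_le_eDiv hD
    (fun z => hf.isMinorant_bregman (ha.trans_le (htab z).1) (ha.trans_le (hsab z).1)
      (ha.trans_le (hdab z).1)) ((i1t.add i1s).sub i1d) (((i2t.add i2s).sub i2d).sub icross)
  have k1 := integral_sub (i1t.add i1s) i1d
  have k2 := integral_add i1t i1s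
  have k3 := integral_sub ((i2t.add i2s).sub i2d) icross
  have k4 := integral_sub (i2t.add i2s) i2d
  have k5 := integral_add i2t i2s
  simp only [Pi.add_apply, Pi.sub_apply] at k1 k2 k3 k4 k5
  rw [k1, k2, k3, k4, k5, hcross] at key
  rw [e1, e2]
  rw [e3] at hle
  simp only [tangentFunctional] at hle ⊢
  linarith

/-- For `f` in the class, the difference of divergences in the MBGYA information decreases under
processing of the second variable. -/
theorem eDiv_add_eDiv_snd_le {γ : Type*} [MeasurableSpace γ] (hf : MemClassF f)
    (hn : IsNonnegGenerator f) (ρ : Measure (α × β)) [IsProbabilityMeasure ρ] (P : Measure α)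
    [IsProbabilityMeasure P] (M : Measure β) [IsProbabilityMeasure M] {g : β → γ}
    (hg : Measurable g) :
    eDiv f (ρ.map (Prod.map id g)) (P.prod (M.map g)) + eDiv f ρ.snd M
      ≤ eDiv f ρ (P.prod M) + eDiv f (ρ.snd.map g) (M.map g) := by
  rcases eq_or_ne (eDiv f ρ (P.prod M)) ∞ with hD | hD
  · simp [hD]
  have hg' : Measurable (Prod.map id g : α × β → α × γ) := measurable_id.prodMap hg
  have hρ' : IsProbabilityMeasure (ρ.map (Prod.map id g)) :=
    Measure.isProbabilityMeasure_map hg'.aemeasurable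
  have hM' : IsProbabilityMeasure (M.map g) := Measure.isProbabilityMeasure_map hg.aemeasurable
  have hD' : eDiv f (ρ.map (Prod.map id g)) (P.prod (M.map g)) ≠ ∞ := by
    refine ((?_ : _ ≤ eDiv f ρ (P.prod M)).trans_lt (lt_top_iff_ne_top.2 hD)).ne
    have : P.prod (M.map g) = (P.prod M).map (Prod.map id g) := by
      rw [← Measure.map_prod_map _ _ measurable_id hg, Measure.map_id]
    rw [this]
    exact eDiv_map_le f _ _ hg'
  have hS : eDiv f ρ.snd M ≠ ∞ :=
    ((eDiv_snd_le f ρ P M).trans_lt (lt_top_iff_ne_top.2 hD)).ne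
  have hE : eDiv f (ρ.snd.map g) (M.map g) ≠ ∞ :=
    ((eDiv_map_le f _ _ hg).trans_lt (lt_top_iff_ne_top.2 hS)).ne
  -- The supremum is taken over `T` with `S` fixed and then over `S`; the ranges of the two
  -- functions are merged into one interval.
  have h1 : ∀ (S : β → ℝ) (a b : ℝ), Measurable S → 0 < a → (∀ x, S x ∈ Icc a b) →
      (eDiv f (ρ.map (Prod.map id g)) (P.prod (M.map g))).toReal
        ≤ (eDiv f ρ (P.prod M)).toReal + (eDiv f (ρ.snd.map g) (M.map g)).toReal
          - tangentFunctional f ρ.snd M S := by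
    intro S a b hSm ha hSab
    refine toReal_eDiv_le hf hn (ac_of_eDiv_ne_top hn hf.slopeAtTop_eq_top hD')
      fun T a' b' hTm ha' hTab => ?_
    rw [le_sub_iff_add_le]
    exact tangentFunctional_add_le hf ρ P M hg hD hE (lt_min ha ha') hTm
      (fun x => Icc_subset_Icc (min_le_right a a') (le_max_right b b') (hTab x)) hSm
      (fun x => Icc_subset_Icc (min_le_left a a') (le_max_left b b') (hSab x))
  have h2 := toReal_eDiv_le hf hn (ac_of_eDiv_ne_top hn hf.slopeAtTop_eq_top hS)
    fun S a b hSm ha hSab => le_sub_comm.1 (h1 S a b hSm ha hSab)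
  rw [← ENNReal.toReal_le_toReal (ENNReal.add_ne_top.2 ⟨hD', hS⟩) (ENNReal.add_ne_top.2 ⟨hD, hE⟩),
    ENNReal.toReal_add hD' hS, ENNReal.toReal_add hD hE]
  linarith

end

/-! ### Convexity of MBGYA in the channel, through labelled mixtures. -/

section

variable {α β ι : Type*} [MeasurableSpace α] [MeasurableSpace β] [Fintype ι] [MeasurableSpace ι]
  {f : ℝ → ℝ} {w : ι → ℝ≥0}

/-- The joint law of the mixing variable and of a variable with conditional laws `R q`. -/
noncomputable def labelledMixture (w : ι → ℝ≥0) (R : ι → Measure β) : Measure (ι × β) :=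
  ∑ q, w q • (R q).map (Prod.mk q)

lemma labelledMixture_restrict [MeasurableSingletonClass ι] (w : ι → ℝ≥0) (R : ι → Measure β)
    (q : ι) : (labelledMixture w R).restrict {z | z.1 = q} = w q • (R q).map (Prod.mk q) := by
  classical
  have hS : MeasurableSet {z : ι × β | z.1 = q} := measurable_fst (measurableSet_singleton q)
  ext A hA
  rw [Measure.restrict_apply hA, labelledMixture]
  simp only [Measure.finsetSum_apply, Measure.smul_apply]
  rw [Finset.sum_eq_single q]
  · rw [Measure.map_apply measurable_prodMk_left (hA.inter hS),
      Measure.map_apply measurable_prodMk_left hA]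
    congr 2
    ext y
    simp
  · intro p _ hp
    rw [Measure.map_apply measurable_prodMk_left (hA.inter hS)]
    have : Prod.mk p ⁻¹' (A ∩ {z : ι × β | z.1 = q}) = ∅ := by
      ext y
      simp [hp]
    simp [this]
  · simp

lemma labelledMixture_map_snd (w : ι → ℝ≥0) (R : ι → Measure β) :
    (labelledMixture w R).map Prod.snd = ∑ q, w q • R q := by
  rw [labelledMixture, map_sum_smul _ _ measurable_snd]
  refine Finset.sum_congr rfl fun q _ => ?_
  rw [Measure.map_map measurable_snd measurable_prodMk_left]
  congr 1
  exact Measure.map_id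

lemma isProbabilityMeasure_labelledMixture (hw : ∑ q, w q = 1) (R : ι → Measure β)
    [∀ q, IsProbabilityMeasure (R q)] : IsProbabilityMeasure (labelledMixture w R) :=
  have (q : ι) : IsProbabilityMeasure ((R q).map (Prod.mk q)) :=
    Measure.isProbabilityMeasure_map measurable_prodMk_left.aemeasurable
  isProbabilityMeasure_sum_smul hw _

/-- The label can be read off, so its level sets cut both mixtures into their components by common
densities. -/
lemma sum_eDiv_le_eDiv_labelledMixture [MeasurableSingletonClass ι] (f : ℝ → ℝ)
    (hw : ∑ q, w q = 1) (R S : ι → Measure β) [∀ q, IsProbabilityMeasure (R q)]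
    [∀ q, IsProbabilityMeasure (S q)] :
    ∑ q, w q * eDiv f (R q) (S q) ≤ eDiv f (labelledMixture w R) (labelledMixture w S) := by
  classical
  have h1 := isProbabilityMeasure_labelledMixture hw R
  have h2 := isProbabilityMeasure_labelledMixture hw S
  have hS : ∀ q : ι, MeasurableSet {z : ι × β | z.1 = q} := fun q =>
    measurable_fst (measurableSet_singleton q)
  have h := sum_eDiv_withDensity_le f (labelledMixture w R) (labelledMixture w S)
    (g := fun q => {z : ι × β | z.1 = q}.indicator 1) (fun q => measurable_one.indicator (hS q))
    fun z => by simp [indicator]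
  simp only [withDensity_indicator_one (hS _), labelledMixture_restrict, eDiv_smul] at h
  refine le_trans (Finset.sum_le_sum fun q _ => ?_) h
  gcongr
  have h3 := eDiv_map_le f ((R q).map (Prod.mk q)) ((S q).map (Prod.mk q)) measurable_snd
  rw [Measure.map_map measurable_snd measurable_prodMk_left,
    Measure.map_map measurable_snd measurable_prodMk_left] at h3
  have e : ∀ R : Measure β, R.map (Prod.snd ∘ Prod.mk q) = R := fun R => Measure.map_id
  rwa [e, e] at h3

variable {ρ : ι → Measure (α × β)} {P : Measure α}

/-- For a fixed first marginal, the difference of divergences in the MBGYA information is jointly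
convex. -/
lemma eDiv_mixture_add_le [MeasurableSingletonClass ι] (hf : MemClassF f)
    (hn : IsNonnegGenerator f) (hw : ∑ q, w q = 1) [IsProbabilityMeasure P]
    [∀ q, IsProbabilityMeasure (ρ q)] (Q : ι → Measure β) [∀ q, IsProbabilityMeasure (Q q)] :
    eDiv f (∑ q, w q • ρ q) (P.prod (∑ q, w q • Q q)) + ∑ q, w q * eDiv f (ρ q).snd (Q q)
      ≤ ∑ q, w q * eDiv f (ρ q) (P.prod (Q q))
        + eDiv f (∑ q, w q • ρ q).snd (∑ q, w q • Q q) := by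
  have hlab : ∀ q : ι, Measurable (Prod.map id (Prod.mk q) : α × β → α × (ι × β)) := fun q =>
    measurable_id.prodMap measurable_prodMk_left
  have hprob : ∀ q, IsProbabilityMeasure ((ρ q).map (Prod.map id (Prod.mk q))) := fun q =>
    Measure.isProbabilityMeasure_map (hlab q).aemeasurable
  have hprobQ : ∀ q, IsProbabilityMeasure ((Q q).map (Prod.mk q)) := fun q =>
    Measure.isProbabilityMeasure_map measurable_prodMk_left.aemeasurable
  set σ : Measure (α × (ι × β)) := ∑ q, w q • (ρ q).map (Prod.map id (Prod.mk q))
  have hσ : IsProbabilityMeasure σ := isProbabilityMeasure_sum_smul hw _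
  set M := labelledMixture w Q
  have hM : IsProbabilityMeasure M := isProbabilityMeasure_labelledMixture hw Q
  -- With the label kept in the second variable, both divergences can be compared with the averages
  -- over `q`, in the directions needed; processing by `Prod.snd` forgets the label and leaves the
  -- mixtures.
  have h := eDiv_add_eDiv_snd_le hf hn σ P M (g := Prod.snd) measurable_snd
  have e1 : σ.map (Prod.map id Prod.snd) = ∑ q, w q • ρ q := by
    have hm : Measurable (Prod.map id Prod.snd : α × (ι × β) → α × β) :=
      measurable_id.prodMap measurable_snd
    rw [map_sum_smul _ _ hm]
    refine Finset.sum_congr rfl fun q _ => ?_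
    rw [Measure.map_map hm (hlab q)]
    congr 1
    exact Measure.map_id
  have e2 : σ.snd = labelledMixture w fun q => (ρ q).snd := by
    rw [Measure.snd, map_sum_smul _ _ measurable_snd, labelledMixture]
    refine Finset.sum_congr rfl fun q _ => ?_
    rw [Measure.map_map measurable_snd (hlab q), Measure.snd,
      Measure.map_map measurable_prodMk_left measurable_snd]
    rfl
  have h1 : eDiv f σ (P.prod M) ≤ ∑ q, w q * eDiv f (ρ q) (P.prod (Q q)) := by
    refine (eDiv_prod_sum_smul_le f w fun q => (Q q).map (Prod.mk q)).trans ?_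
    gcongr with q
    have : P.prod ((Q q).map (Prod.mk q)) = (P.prod (Q q)).map (Prod.map id (Prod.mk q)) := by
      rw [← Measure.map_prod_map _ _ measurable_id measurable_prodMk_left, Measure.map_id]
    rw [this]
    exact eDiv_map_le f _ _ (hlab q)
  have h2 := sum_eDiv_le_eDiv_labelledMixture f hw (fun q => (ρ q).snd) Q
  rw [e1, e2, labelledMixture_map_snd, labelledMixture_map_snd, ← snd_sum_smul] at h
  exact (add_le_add_right h2 _).trans (h.trans (add_le_add_left h1 _))

lemma eMBGYA_le_sum [MeasurableSingletonClass ι] (hf : MemClassF f)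
    (hn : IsNonnegGenerator f) (hw : ∑ q, w q = 1) [IsProbabilityMeasure P]
    [∀ q, IsProbabilityMeasure (ρ q)] (hP : ∀ q, (ρ q).fst = P) :
    eMBGYA f (∑ q, w q • ρ q) ≤ ∑ q, w q * eMBGYA f (ρ q) := by
  have := fun q => hn.mbgyaIndex_nonempty (ρ q)
  refine ENNReal.le_sum_mul_iInf w (fun q (Q : MBGYAIndex f (ρ q)) =>
    eDiv f (ρ q) ((ρ q).fst.prod Q.1) - eDiv f (ρ q).snd Q.1) fun Q => ?_
  have hQ : ∀ q, IsProbabilityMeasure (Q q).1 := fun q => (Q q).2.1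
  have hac : (∑ q, w q • ρ q).snd ≪ ∑ q, w q • (Q q).1 := by
    rw [snd_sum_smul]
    exact sum_smul_absolutelyContinuous fun q => (Q q).2.2.1
  have hsum : ∑ q, w q * eDiv f (ρ q).snd (Q q).1 ≠ ∞ :=
    ENNReal.sum_ne_top.2 fun q _ => ENNReal.mul_ne_top ENNReal.coe_ne_top (Q q).2.2.2
  have hfin : eDiv f (∑ q, w q • ρ q).snd (∑ q, w q • (Q q).1) ≠ ∞ := by
    rw [snd_sum_smul]
    exact ((eDiv_sum_smul_le f w (fun q => (ρ q).snd) fun q => (Q q).1).trans_lt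
      (lt_top_iff_ne_top.2 hsum)).ne
  refine (iInf_le _ (⟨_, isProbabilityMeasure_sum_smul hw fun q => (Q q).1, hac, hfin⟩ :
    MBGYAIndex f _)).trans ?_
  simp only [hP]
  -- All subtractions are traded for additions of finite terms, so that `eDiv_mixture_add_le`,
  -- stated without subtraction, applies.
  rw [fst_sum_smul_of_fst_eq hw hP, tsub_le_iff_right, ← ENNReal.add_le_add_iff_right hsum]
  refine (eDiv_mixture_add_le hf hn hw fun q => (Q q).1).trans (le_of_eq ?_)
  rw [add_right_comm, ← Finset.sum_add_distrib]
  congr 1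
  refine Finset.sum_congr rfl fun q _ => ?_
  rw [← mul_add, tsub_add_cancel_of_le (eDiv_snd_le _ _ _ _)]

end

/-! ### Superadditivity for independent variables. -/

section

variable {Ω 𝒰 : Type*} [MeasurableSpace Ω] [MeasurableSpace 𝒰] {f : ℝ → ℝ}

lemma iIndepFun.map_piFinSuccAbove_zero {n : ℕ} {E : Fin (n + 1) → Type*}
    [∀ i, MeasurableSpace (E i)] {μ : Measure Ω} [IsProbabilityMeasure μ]
    {X : (i : Fin (n + 1)) → Ω → E i} (hX : ∀ i, Measurable (X i)) (hind : iIndepFun X μ) :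
    (μ.map fun ω i => X i ω).map (MeasurableEquiv.piFinSuccAbove E 0)
      = (μ.map (X 0)).prod (μ.map fun ω j => X (Fin.succAbove 0 j) ω) := by
  have hp : ∀ i, IsProbabilityMeasure (μ.map (X i)) := fun i =>
    Measure.isProbabilityMeasure_map (hX i).aemeasurable
  rw [(iIndepFun_iff_map_fun_eq_pi_map fun i => (hX i).aemeasurable).1 hind,
    (measurePreserving_piFinSuccAbove (fun i => μ.map (X i)) 0).map_eq,
    (iIndepFun_iff_map_fun_eq_pi_map fun j => (hX (Fin.succAbove 0 j)).aemeasurable).1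
      (hind.precomp Fin.succAbove_right_injective)]

/-- Superadditivity of the divergences in the informations `I(X₁, …, Xₙ; U)` for independent
`Xᵢ`. -/
lemma sum_eDiv_add_le (hf : MemClassF f) (hn : IsNonnegGenerator f) (μ : Measure Ω)
    [IsProbabilityMeasure μ] {U : Ω → 𝒰} (hU : Measurable U) (Q : Measure 𝒰)
    [IsProbabilityMeasure Q] {n : ℕ} {E : Fin n → Type*} [∀ i, MeasurableSpace (E i)]
    (X : (i : Fin n) → Ω → E i) (hX : ∀ i, Measurable (X i)) (hind : iIndepFun X μ) :
    ∑ i, eDiv f (μ.map fun ω => (X i ω, U ω)) ((μ.map (X i)).prod Q) + eDiv f (μ.map U) Q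
      ≤ eDiv f (μ.map fun ω => ((fun i => X i ω), U ω)) ((μ.map fun ω i => X i ω).prod Q)
        + n * eDiv f (μ.map U) Q := by
  induction n with
  | zero =>
    have hXm : Measurable fun ω (i : Fin 0) => X i ω := measurable_pi_lambda _ hX
    have h1 := Measure.isProbabilityMeasure_map (μ := μ) hXm.aemeasurable
    have h2 := Measure.isProbabilityMeasure_map (μ := μ) (hXm.prodMk hU).aemeasurable
    have h := eDiv_snd_le f (μ.map fun ω => ((fun i => X i ω), U ω)) (μ.map fun ω i => X i ω) Q
    rw [Measure.snd_map_prodMk hXm] at h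
    simpa using h
  | succ n ih =>
    have hXm : Measurable fun ω i => X i ω := measurable_pi_lambda _ hX
    set Y : Ω → (j : Fin n) → E (Fin.succAbove 0 j) := fun ω j => X (Fin.succAbove 0 j) ω
    have hY : Measurable Y := measurable_pi_lambda _ fun j => hX _
    have p0 := Measure.isProbabilityMeasure_map (μ := μ) (hX 0).aemeasurable
    have pX := Measure.isProbabilityMeasure_map (μ := μ) hXm.aemeasurable
    have pY := Measure.isProbabilityMeasure_map (μ := μ) hY.aemeasurable
    have pXU := Measure.isProbabilityMeasure_map (μ := μ) (hXm.prodMk hU).aemeasurable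
    have pρ := Measure.isProbabilityMeasure_map (μ := μ) ((hX 0).prodMk (hY.prodMk hU)).aemeasurable
    have hIH := ih (fun j => X (Fin.succAbove 0 j)) (fun j => hX _)
      (hind.precomp Fin.succAbove_right_injective)
    -- The second variable is the pair of the remaining variables `Y` and `U`, and the processing
    -- forgets `Y`. The result is superadditivity for the two blocks `X 0` and `Y`, at the cost of
    -- one copy of `D(P_U ‖ Q)`.
    have hmaster := eDiv_add_eDiv_snd_le hf hn (μ.map fun ω => (X 0 ω, (Y ω, U ω))) (μ.map (X 0))
      ((μ.map Y).prod Q) (g := Prod.snd) measurable_snd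
    have hm : Measurable (Prod.map id Prod.snd :
        E 0 × (((j : Fin n) → E (Fin.succAbove 0 j)) × 𝒰) → E 0 × 𝒰) :=
      measurable_id.prodMap measurable_snd
    have e1 : (μ.map fun ω => (X 0 ω, (Y ω, U ω))).map (Prod.map id Prod.snd)
        = μ.map fun ω => (X 0 ω, U ω) := by
      rw [Measure.map_map hm ((hX 0).prodMk (hY.prodMk hU))]
      rfl
    have e2 : ((μ.map Y).prod Q).map Prod.snd = Q := Measure.snd_prod
    have e3 : (μ.map fun ω => (Y ω, U ω)).map Prod.snd = μ.map U :=
      Measure.snd_map_prodMk hY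
    rw [Measure.snd_map_prodMk (hX 0), e1, e2, e3] at hmaster
    set e := MeasurableEquiv.piFinSuccAbove E 0
    set ψ : ((i : Fin (n + 1)) → E i) × 𝒰 → E 0 × (((j : Fin n) → E (Fin.succAbove 0 j)) × 𝒰) :=
      fun z => MeasurableEquiv.prodAssoc (Prod.map e id z)
    have hψ : Measurable ψ :=
      MeasurableEquiv.prodAssoc.measurable.comp (e.measurable.prodMap measurable_id)
    have hle := eDiv_map_le f (μ.map fun ω => ((fun i => X i ω), U ω))
      ((μ.map fun ω i => X i ω).prod Q) hψ
    have e4 : (μ.map fun ω => ((fun i => X i ω), U ω)).map ψ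
        = μ.map fun ω => (X 0 ω, (Y ω, U ω)) := by
      rw [Measure.map_map hψ (hXm.prodMk hU)]
      rfl
    have e5 : ((μ.map fun ω i => X i ω).prod Q).map ψ
        = (μ.map (X 0)).prod ((μ.map Y).prod Q) := by
      -- Independence is used here: the law of all variables factors as the law of `X 0` times the
      -- law of `Y`.
      have h1 : (((μ.map fun ω i => X i ω).prod Q).map (Prod.map e id))
          = ((μ.map (X 0)).prod (μ.map Y)).prod Q := by
        rw [← Measure.map_prod_map _ _ e.measurable measurable_id, Measure.map_id,
          iIndepFun.map_piFinSuccAbove_zero hX hind]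
      have h2 : ψ = MeasurableEquiv.prodAssoc ∘ Prod.map e id := rfl
      rw [h2, ← Measure.map_map MeasurableEquiv.prodAssoc.measurable
        (e.measurable.prodMap measurable_id), h1, Measure.prodAssoc_prod]
    rw [e4, e5] at hle
    rw [Fin.sum_univ_succAbove _ 0]
    set d := eDiv f (μ.map U) Q
    calc _ = eDiv f (μ.map fun ω => (X 0 ω, U ω)) ((μ.map (X 0)).prod Q)
          + (∑ j, eDiv f (μ.map fun ω => (X (Fin.succAbove 0 j) ω, U ω))
            ((μ.map (X (Fin.succAbove 0 j))).prod Q) + d) := by rw [add_assoc]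
      _ ≤ eDiv f (μ.map fun ω => (X 0 ω, U ω)) ((μ.map (X 0)).prod Q)
          + (eDiv f (μ.map fun ω => (Y ω, U ω)) ((μ.map Y).prod Q) + n * d) :=
        add_le_add_right hIH _
      _ = eDiv f (μ.map fun ω => (X 0 ω, U ω)) ((μ.map (X 0)).prod Q)
          + eDiv f (μ.map fun ω => (Y ω, U ω)) ((μ.map Y).prod Q) + n * d := by rw [add_assoc]
      _ ≤ _ := by
        refine (add_le_add_left (hmaster.trans (add_le_add_left hle _)) _).trans (le_of_eq ?_)
        push_cast
        ring

lemma sum_eCKZ_le (hf : MemClassF f) (hn : IsNonnegGenerator f) (μ : Measure Ω)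
    [IsProbabilityMeasure μ] {U : Ω → 𝒰} (hU : Measurable U) {n : ℕ} {E : Fin n → Type*}
    [∀ i, MeasurableSpace (E i)] (X : (i : Fin n) → Ω → E i) (hX : ∀ i, Measurable (X i))
    (hind : iIndepFun X μ) :
    ∑ i, eCKZ f (μ.map fun ω => (X i ω, U ω)) ≤ eCKZ f (μ.map fun ω => ((fun i => X i ω), U ω)) := by
  have hXm : Measurable fun ω i => X i ω := measurable_pi_lambda _ hX
  have pU : IsProbabilityMeasure (μ.map U) := Measure.isProbabilityMeasure_map hU.aemeasurable
  -- With `Q = P_U` the correction terms `D(P_U ‖ Q)` vanish.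
  have h := sum_eDiv_add_le hf hn μ hU (μ.map U) X hX hind
  rw [hn.eDiv_self] at h
  simp only [mul_zero, add_zero] at h
  simp only [eCKZ, Measure.fst_map_prodMk hU, Measure.snd_map_prodMk hXm,
    Measure.snd_map_prodMk (hX _)]
  exact h

lemma sum_eMBGYA_le_of_iIndepFun (hf : MemClassF f) (hn : IsNonnegGenerator f) (μ : Measure Ω)
    [IsProbabilityMeasure μ] {U : Ω → 𝒰} (hU : Measurable U) {n : ℕ} {E : Fin n → Type*}
    [∀ i, MeasurableSpace (E i)] (X : (i : Fin n) → Ω → E i) (hX : ∀ i, Measurable (X i))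
    (hind : iIndepFun X μ) :
    ∑ i, eMBGYA f (μ.map fun ω => (X i ω, U ω))
      ≤ eMBGYA f (μ.map fun ω => ((fun i => X i ω), U ω)) := by
  have hXm : Measurable fun ω i => X i ω := measurable_pi_lambda _ hX
  have pi : ∀ i, IsProbabilityMeasure (μ.map (X i)) := fun i =>
    Measure.isProbabilityMeasure_map (hX i).aemeasurable
  have piU : ∀ i, IsProbabilityMeasure (μ.map fun ω => (X i ω, U ω)) := fun i =>
    Measure.isProbabilityMeasure_map ((hX i).prodMk hU).aemeasurable
  have si : ∀ i, (μ.map fun ω => (X i ω, U ω)).snd = μ.map U := fun i =>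
    Measure.snd_map_prodMk (hX i)
  refine le_iInf fun ⟨Q, hQ, hac, hd⟩ => ?_
  rw [Measure.snd_map_prodMk hXm] at hac hd
  dsimp only
  rw [Measure.snd_map_prodMk hXm, Measure.fst_map_prodMk hU]
  have h := sum_eDiv_add_le hf hn μ hU Q X hX hind
  set d := eDiv f (μ.map U) Q
  refine ENNReal.le_sub_of_add_le_right hd ?_
  have hnd : (n : ℝ≥0∞) * d ≠ ∞ := ENNReal.mul_ne_top (ENNReal.natCast_ne_top n) hd
  rw [← ENNReal.add_le_add_iff_right hnd]
  refine le_trans ?_ h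
  rw [add_right_comm]
  refine add_le_add_left ?_ _
  have hc : (n : ℝ≥0∞) * d = ∑ _i : Fin n, d := by simp
  rw [hc, ← Finset.sum_add_distrib]
  refine Finset.sum_le_sum fun i _ => ?_
  have hle : d ≤ eDiv f (μ.map fun ω => (X i ω, U ω)) ((μ.map (X i)).prod Q) := by
    have := eDiv_snd_le f (μ.map fun ω => (X i ω, U ω)) (μ.map (X i)) Q
    rwa [si] at this
  refine (add_le_add_left (iInf_le _ (⟨Q, hQ, by rwa [si], by rwa [si]⟩ : MBGYAIndex f _)) _).trans
    (le_of_eq ?_)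
  dsimp only
  rw [si, Measure.fst_map_prodMk hU, tsub_add_cancel_of_le hle]

end

/-! ### Comparison of the three informations with Shannon's. -/

section

variable {α β : Type*} [MeasurableSpace α] [MeasurableSpace β] {f : ℝ → ℝ}

lemma ePV_le_eCKZ (f : ℝ → ℝ) (ρ : Measure (α × β)) [IsProbabilityMeasure ρ] :
    ePV f ρ ≤ eCKZ f ρ :=
  iInf_le _ (⟨ρ.snd, inferInstance, Measure.AbsolutelyContinuous.rfl⟩ : PVIndex ρ)

lemma eMBGYA_le_ePV (f : ℝ → ℝ) (ρ : Measure (α × β)) [IsProbabilityMeasure ρ] :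
    eMBGYA f ρ ≤ ePV f ρ := by
  refine le_iInf fun ⟨Q, hQ, hac⟩ => ?_
  rcases eq_or_ne (eDiv f ρ.snd Q) ∞ with h | h
  · have := eDiv_snd_le f ρ ρ.fst Q
    -- A `Q` excluded from the MBGYA infimum gives the value `∞` for PV by data processing, so
    -- excluding it loses nothing.
    rw [h, top_le_iff] at this
    rw [this]
    exact le_top
  · exact (iInf_le _ (⟨Q, hQ, hac, h⟩ : MBGYAIndex f ρ)).trans tsub_le_self

/-- Both sides and their first derivatives vanish at `1` (for `f` because it has its minimum there),
and `f''(t) ≤ L / t`, which is the second derivative of the right side. -/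
lemma MemClassF.le_mul_klFun (hf : MemClassF f) (hn : IsNonnegGenerator f) {L : ℝ}
    (hL : ∀ t, 0 < t → t * deriv (deriv f) t ≤ L) {t : ℝ} (ht : 0 < t) :
    f t ≤ L * InformationTheory.klFun t := by
  have hd1 : deriv f 1 = 0 := by
    have hmin : IsLocalMin f 1 := by
      filter_upwards [Ioi_mem_nhds one_pos] with s hs
      rw [hf.map_one]
      exact hn.nonneg s hs
    exact hmin.deriv_eq_zero
  have seg : ∀ l ∈ Icc (0 : ℝ) 1, 0 < 1 + l * (t - 1) := by
    intro l hl
    have : 0 < (1 - l) * 1 + l * t :=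
      (convex_Ioi (0 : ℝ)) (mem_Ioi.2 one_pos) (mem_Ioi.2 ht) (by linarith [hl.2]) hl.1 (by ring)
    linarith
  have hl : ∀ l : ℝ, HasDerivAt (fun l => 1 + l * (t - 1)) (t - 1) l := fun l => by
    simpa using ((hasDerivAt_id l).mul_const (t - 1)).const_add 1
  have d1 : ∀ l ∈ Icc (0 : ℝ) 1,
      HasDerivAt (fun l => InformationTheory.klFun (1 + l * (t - 1)))
        (Real.log (1 + l * (t - 1)) * (t - 1)) l := fun l hl' =>
    HasDerivAt.comp (h₂ := InformationTheory.klFun) l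
      (InformationTheory.hasDerivAt_klFun (seg l hl').ne') (hl l)
  have d2 : ∀ l ∈ Icc (0 : ℝ) 1, HasDerivAt (fun l => Real.log (1 + l * (t - 1)) * (t - 1))
      ((1 + l * (t - 1))⁻¹ * (t - 1) * (t - 1)) l := fun l hl' =>
    ((Real.hasDerivAt_log (seg l hl').ne').comp l (hl l)).mul_const _
  have d3 : ∀ l ∈ Icc (0 : ℝ) 1, HasDerivAt (fun l => f (1 + l * (t - 1)))
      (deriv f (1 + l * (t - 1)) * (t - 1)) l := fun l hl' =>
    (hf.hasDerivAt (seg l hl')).comp l (hl l)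
  have d4 : ∀ l ∈ Icc (0 : ℝ) 1, HasDerivAt (fun l => deriv f (1 + l * (t - 1)) * (t - 1))
      (deriv (deriv f) (1 + l * (t - 1)) * (t - 1) * (t - 1)) l := fun l hl' =>
    ((hf.hasDerivAt_deriv (seg l hl')).comp l (hl l)).mul_const _
  have h := add_deriv_le_of_deriv2_nonneg
    (k := fun l => L * InformationTheory.klFun (1 + l * (t - 1)) - f (1 + l * (t - 1)))
    (k' := fun l => L * (Real.log (1 + l * (t - 1)) * (t - 1))
      - deriv f (1 + l * (t - 1)) * (t - 1))
    (fun l hl' => ((d1 l hl').const_mul L).sub (d3 l hl'))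
    (fun l hl' => ((d2 l hl').const_mul L).sub (d4 l hl'))
    fun l hl' => by
      have hp := seg l hl'
      have h1 := hL _ hp
      have h2 : deriv (deriv f) (1 + l * (t - 1)) ≤ L * (1 + l * (t - 1))⁻¹ := by
        rwa [← div_eq_mul_inv, le_div_iff₀ hp, mul_comm]
      nlinarith [mul_nonneg (sub_nonneg.2 h2) (sq_nonneg (t - 1))]
  simp only [zero_mul, add_zero, one_mul, add_sub_cancel, InformationTheory.klFun_one,
    Real.log_one, hf.map_one, hd1, mul_zero, sub_zero] at h
  linarith

lemma MemClassF.eDiv_le_mul_klDiv (hf : MemClassF f) (hn : IsNonnegGenerator f) {L : ℝ}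
    (hL0 : 0 ≤ L) (hL : ∀ t, 0 < t → t * deriv (deriv f) t ≤ L) (P Q : Measure α)
    [IsFiniteMeasure P] [IsFiniteMeasure Q] (hac : P ≪ Q) :
    eDiv f P Q ≤ ENNReal.ofReal L * InformationTheory.klDiv P Q := by
  have hpt : ∀ r : ℝ≥0∞, r ≠ ∞ →
      persp f r 1 ≤ ENNReal.ofReal L * ENNReal.ofReal (InformationTheory.klFun r.toReal) := by
    intro r hr
    refine persp_le hr (by simp) fun a b hab => ?_
    rw [← ENNReal.ofReal_mul hL0, ENNReal.toReal_one, mul_one]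
    refine ENNReal.ofReal_le_ofReal ?_
    -- Approaching the density from the right covers the value `0`, where `le_mul_klFun` does not
    -- apply directly.
    have h1 : Tendsto (fun t => a * t + b) (𝓝[>] r.toReal) (𝓝 (a * r.toReal + b)) :=
      (Continuous.tendsto (by fun_prop) _).mono_left nhdsWithin_le_nhds
    have h2 : Tendsto (fun t => L * InformationTheory.klFun t) (𝓝[>] r.toReal)
        (𝓝 (L * InformationTheory.klFun r.toReal)) :=
      ((InformationTheory.continuous_klFun.const_mul L).tendsto _).mono_left nhdsWithin_le_nhds
    refine le_of_tendsto_of_tendsto h1 h2 ?_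
    filter_upwards [self_mem_nhdsWithin] with t ht
    have ht0 : 0 < t := lt_of_le_of_lt ENNReal.toReal_nonneg ht
    exact (hab t ht0).trans (hf.le_mul_klFun hn hL ht0)
  rw [eDiv_eq_rnDeriv, (Measure.singularPart_eq_zero P Q).2 hac,
    InformationTheory.klDiv_eq_lintegral_klFun_of_ac hac,
    ← lintegral_const_mul' _ _ ENNReal.ofReal_ne_top]
  simp only [Measure.coe_zero, Pi.zero_apply, mul_zero, add_zero]
  refine lintegral_mono_ae ?_
  filter_upwards [Measure.rnDeriv_lt_top P Q] with x hx using hpt _ hx.ne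

lemma MemClassF.coe_eDiv_le (hf : MemClassF f) (hn : IsNonnegGenerator f) {L : EReal}
    (hL0 : 0 < L) (hL : ∀ t : ℝ, 0 < t → ((t * deriv (deriv f) t : ℝ) : EReal) ≤ L)
    (P Q : Measure α) [IsFiniteMeasure P] [IsFiniteMeasure Q] :
    (eDiv f P Q : EReal) ≤ (InformationTheory.klDiv P Q : EReal) * L := by
  rcases eq_or_ne (InformationTheory.klDiv P Q) ∞ with htop | htop
  · rw [htop, EReal.coe_ennreal_top, EReal.top_mul_of_pos hL0]
    exact le_top
  have hac := (InformationTheory.klDiv_ne_top_iff.1 htop).1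
  -- Zero information must be separated because of `0 * ∞ = 0`: then `P = Q`, and the `f`-divergence
  -- vanishes as well.
  rcases eq_or_ne (InformationTheory.klDiv P Q) 0 with h0 | h0
  · rw [InformationTheory.klDiv_eq_zero_iff.1 h0, hn.eDiv_self]
    simp
  induction L with
  | bot => exact absurd hL0 (by simp)
  | top =>
    rw [EReal.coe_ennreal_mul_top h0]
    exact le_top
  | coe L =>
    have hL0' : 0 ≤ L := (EReal.coe_pos.1 hL0).le
    have h := hf.eDiv_le_mul_klDiv hn hL0' (fun t ht => EReal.coe_le_coe_iff.1 (hL t ht)) P Q hac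
    have e : (L : EReal) = ((ENNReal.ofReal L : ℝ≥0∞) : EReal) := by
      rw [EReal.coe_ennreal_ofReal, max_eq_left hL0']
    rw [e, ← EReal.coe_ennreal_mul, EReal.coe_ennreal_le_coe_ennreal_iff, mul_comm]
    exact h

end

theorem mainTheorem6
    {𝒳 𝒴 𝒬 : Type*} [MeasurableSpace 𝒳] [MeasurableSpace 𝒴] [Fintype 𝒬]
    {Ω 𝒰 : Type*} [MeasurableSpace Ω] [MeasurableSpace 𝒰]
    {n : ℕ} {𝒳s : Fin n → Type*} [∀ i, MeasurableSpace (𝒳s i)] :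
    -- (i) PV and MBGYA are concave in the input law `P_X` for a fixed channel `κ`: `I(X;Y) ≥ I(X;Y|Q)`
    (∀ f : ℝ → ℝ, IsGenerator f →
      ∀ (κ : Kernel 𝒳 𝒴) (_ : IsMarkovKernel κ)
        (P : 𝒬 → Measure 𝒳) (_ : ∀ q, IsProbabilityMeasure (P q))
        (w : 𝒬 → ℝ≥0), ∑ q, w q = 1 →
        condInfo (infoPV f) w (fun q => P q ⊗ₘ κ) ≤ infoPV f ((∑ q, w q • P q) ⊗ₘ κ) ∧
        condInfo (infoMBGYA f) w (fun q => P q ⊗ₘ κ) ≤ infoMBGYA f ((∑ q, w q • P q) ⊗ₘ κ)) ∧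
    -- (ii) CKZ, PV and (in the class) MBGYA are convex in the channel for a fixed input law `P`:
    -- `I(X;Y) ≤ I(X;Y|Q)`
    (∀ f : ℝ → ℝ, IsGenerator f →
      ∀ (P : Measure 𝒳) (_ : IsProbabilityMeasure P)
        (κ : 𝒬 → Kernel 𝒳 𝒴) (_ : ∀ q, IsMarkovKernel (κ q))
        (w : 𝒬 → ℝ≥0), ∑ q, w q = 1 →
        infoCKZ f (P ⊗ₘ mixChannel w κ) ≤ condInfo (infoCKZ f) w (fun q => P ⊗ₘ κ q) ∧
        infoPV f (P ⊗ₘ mixChannel w κ) ≤ condInfo (infoPV f) w (fun q => P ⊗ₘ κ q) ∧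
        (MemClassF f →
          infoMBGYA f (P ⊗ₘ mixChannel w κ) ≤ condInfo (infoMBGYA f) w (fun q => P ⊗ₘ κ q))) ∧
    -- (iii) the AB property for independent `X 0, …, X (n - 1)` and arbitrary `U`
    (∀ f : ℝ → ℝ, MemClassF f →
      ∀ (μ : Measure Ω) (_ : IsProbabilityMeasure μ)
        (X : (i : Fin n) → Ω → 𝒳s i) (U : Ω → 𝒰), (∀ i, Measurable (X i)) → Measurable U →
        iIndepFun X μ →
        ∑ i, infoCKZ f (μ.map fun ω => (X i ω, U ω))
          ≤ infoCKZ f (μ.map fun ω => ((fun i => X i ω), U ω)) ∧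
        ∑ i, infoMBGYA f (μ.map fun ω => (X i ω, U ω))
          ≤ infoMBGYA f (μ.map fun ω => ((fun i => X i ω), U ω))) ∧
    -- (iv) the limit of `t f''(t)` exists in `[-∞, ∞]`, and the chain of inequalities
    (∀ f : ℝ → ℝ, MemClassF f →
      ∃ L : EReal, Tendsto (fun t : ℝ => ((t * deriv (deriv f) t : ℝ) : EReal)) atTop (𝓝 L) ∧
        ∀ (ρ : Measure (𝒳 × 𝒴)) (_ : IsProbabilityMeasure ρ),
          infoCKZ f ρ ≤ shannonInfo ρ * L ∧
          infoPV f ρ ≤ infoCKZ f ρ ∧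
          infoMBGYA f ρ ≤ infoPV f ρ) := by
  refine ⟨?_, ?_, ?_, ?_⟩
  · intro f hf κ _ P _ w hw
    obtain ⟨c, hn⟩ := hf.exists_shift
    have := isProbabilityMeasure_sum_smul hw P
    rw [condInfo_eq_coe w _ fun q => hn.infoPV_eq (P q ⊗ₘ κ),
      condInfo_eq_coe w _ fun q => hn.infoMBGYA_eq (P q ⊗ₘ κ), hn.infoPV_eq, hn.infoMBGYA_eq,
      EReal.coe_ennreal_le_coe_ennreal_iff, EReal.coe_ennreal_le_coe_ennreal_iff]
    exact ⟨sum_ePV_le _ hw P κ, sum_eMBGYA_le _ hw P κ⟩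
  · intro f hf P _ κ _ w hw
    obtain ⟨c, hn⟩ := hf.exists_shift
    have := isMarkovKernel_mixChannel hw κ
    have hP : ∀ q, (P ⊗ₘ κ q).fst = P := fun q => Measure.fst_compProd P (κ q)
    rw [condInfo_eq_coe w _ fun q => hn.infoCKZ_eq (P ⊗ₘ κ q),
      condInfo_eq_coe w _ fun q => hn.infoPV_eq (P ⊗ₘ κ q),
      condInfo_eq_coe w _ fun q => hn.infoMBGYA_eq (P ⊗ₘ κ q),
      hn.infoCKZ_eq, hn.infoPV_eq, hn.infoMBGYA_eq, EReal.coe_ennreal_le_coe_ennreal_iff,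
      EReal.coe_ennreal_le_coe_ennreal_iff, EReal.coe_ennreal_le_coe_ennreal_iff,
      compProd_mixChannel]
    refine ⟨eCKZ_le_sum _ hw hP, ePV_le_sum _ hw hP, fun hF => ?_⟩
    -- The index set has no σ-algebra of its own; the discrete one makes the label a random variable
    -- whose singletons are measurable.
    let _ : MeasurableSpace 𝒬 := ⊤
    exact eMBGYA_le_sum (hF.shift c).1 hn hw hP
  · intro f hF μ _ X U hX hU hind
    obtain ⟨c, hn⟩ := hF.toIsGenerator.exists_shift
    have hXm : Measurable fun ω i => X i ω := measurable_pi_lambda _ hX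
    have p1 : ∀ i, IsProbabilityMeasure (μ.map fun ω => (X i ω, U ω)) := fun i =>
      Measure.isProbabilityMeasure_map ((hX i).prodMk hU).aemeasurable
    have p2 : IsProbabilityMeasure (μ.map fun ω => ((fun i => X i ω), U ω)) :=
      Measure.isProbabilityMeasure_map (hXm.prodMk hU).aemeasurable
    simp only [hn.infoCKZ_eq, hn.infoMBGYA_eq, ← EReal.coe_ennreal_finsetSum,
      EReal.coe_ennreal_le_coe_ennreal_iff]
    exact ⟨sum_eCKZ_le (hF.shift c).1 hn μ hU X hX hind,
      sum_eMBGYA_le_of_iIndepFun (hF.shift c).1 hn μ hU X hX hind⟩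
  · intro f hF
    obtain ⟨c, hn⟩ := hF.toIsGenerator.exists_shift
    obtain ⟨L, hL, hL0, hle⟩ := hF.exists_tendsto
    refine ⟨L, hL, fun ρ _ => ?_⟩
    rw [hn.infoCKZ_eq, hn.infoPV_eq, hn.infoMBGYA_eq, EReal.coe_ennreal_le_coe_ennreal_iff,
      EReal.coe_ennreal_le_coe_ennreal_iff]
    refine ⟨(hF.shift c).1.coe_eDiv_le hn hL0 (fun t ht => ?_) _ _, ePV_le_eCKZ _ ρ,
      eMBGYA_le_ePV _ ρ⟩
    rw [(hF.shift c).2 t ht]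
    exact hle t ht
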